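/- Let $H$ be a separable complex Hilbert space with orthonormal basis $\{E_k\}_{k\ge0}$, and let $P_{k,l}$ be the matrix units, $P_{k,l}x=\langle E_l,x\rangle E_k$. Let $\mathcal K^\infty$ be the space of smooth compact operators $c=\sum_{k,l\ge0}c_{k,l}P_{k,l}$ with $\{c_{k,l}\}$ rapidly decaying, that is $\sup_{k,l}(1+k+l)^N|c_{k,l}|<\infty$ for all $N$. For $f\in C(\mathbb R/\mathbb Z)$ let $T(f)$ be the Toeplitz operator on $H$, the compression of the multiplication by $f$ on $L^2(\mathbb R/\mathbb Z)$ to the closed span of $\{e^{2\pi ikx}\}_{k\ge0}$, which is identified with $H$ through $e^{2\pi ikx}\mapsto E_k$. Let $$\mathcal T^\infty=\{T(f)+c:\ f\in C^\infty(\mathbb R/\mathbb Z),\ c\in\mathcal K^\infty\},$$ the smooth Toeplitz algebra. The decomposition $a=T(f)+c$ is unique; write $q(a)=f$. Let $\mathbb K$ be the unbounded diagonal operator $\mathbb KE_k=kE_k$ on its maximal domain. Give $\mathcal T^\infty$ the Fréchet topology of the norms $$\|T(f)+c\|_{M,N}=S\,\|f\|_{C^{M+N+2}}+\|c\|_{M,N},\qquad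 M,N=0,1,2,\dots,\qquad S=\tfrac12+\sqrt{\tfrac{4\pi^2-9}{12}},$$ where $\|f\|_{C^l}=\sum_{j=0}^l\binom lj\big\|\big(\tfrac1{2\pi i}\tfrac d{dx}\big)^jf\big\|_\infty$ and $\|c\|_{M,N}=\sum_{j=0}^M\binom Mj\|\delta_{\mathbb K}^j(c)(I+\mathbb K)^N\|$ with $\delta_{\mathbb K}(c)=[\mathbb K,c]$. A derivation of $\mathcal T^\infty$ is a linear map $\delta:\mathcal T^\infty\to\mathcal T^\infty$ with $\delta(ab)=a\,\delta(b)+\delta(a)\,b$; it is inner if $\delta(a)=[\alpha,a]$ for some $\alpha\in\mathcal T^\infty$. For $F=\sum_{n\in\mathbb Z}F_ne^{2\pi inx}\in C^\infty(\mathbb R/\mathbb Z)$ put $F_+=\sum_{n\ge0}F_ne^{2\pi inx}$ and $F_-=\sum_{n<0}F_ne^{2\pi inx}$. **Theorem.** 1. For every $F\in C^\infty(\mathbb R/\mathbb Z)$ the formula $$\delta_F(a)=[T(F_+)\mathbb K+\mathbb KT(F_-),\,a]$$ defines a derivation $\delta_F:\mathcal T^\infty\to\mathcal T^\infty$: every $a\in\mathcal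 T^\infty$ preserves the domain of $T(F_+)\mathbb K+\mathbb KT(F_-)$, and $\delta_F$ is the unique linear map $\mathcal T^\infty\to\mathcal T^\infty$ such that, for every $a$, the operator $\delta_F(a)$ is equal to the commutator on this domain. Moreover, $\delta_F$ is continuous and it lifts the vector field $F\,\frac1{2\pi i}\frac d{dx}$ on the circle, that is $q(\delta_F(a))=F\,\frac1{2\pi i}\frac d{dx}q(a)$ for all $a\in\mathcal T^\infty$. 2. Every derivation $\delta:\mathcal T^\infty\to\mathcal T^\infty$ is continuous, and there is a unique $F\in C^\infty(\mathbb R/\mathbb Z)$ such that $$\delta=\delta_F+\tilde\delta$$ for some inner derivation $\tilde\delta$ of $\mathcal T^\infty$ with $\tilde\delta(\mathcal T^\infty)\subseteq\mathcal K^\infty$. -/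

import Mathlib

noncomputable section

namespace QuantumDisk

open MeasureTheory ContinuousLinearMap
open scoped ENNReal ContDiff Topology InnerProductSpace

set_option linter.unusedSectionVars false

/-! ### Smooth functions on the circle `ℝ / ℤ` -/

/-- The pullback to `ℝ` of a function on the circle `ℝ / ℤ`. -/
def pullback (f : C(UnitAddCircle, ℂ)) : ℝ → ℂ := fun x => f (x : UnitAddCircle)

/-- The algebra `C^∞(ℝ/ℤ)`. -/
def smoothCircle : Subalgebra ℂ C(UnitAddCircle, ℂ) where
  carrier := {f | ContDiff ℝ ∞ (pullback f)}
  mul_mem' {f g} hf hg := by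
    have hf' : ContDiff ℝ ∞ (pullback f) := hf
    exact hf'.mul hg
  add_mem' {f g} hf hg := by
    have hf' : ContDiff ℝ ∞ (pullback f) := hf
    exact hf'.add hg
  algebraMap_mem' r := by
    have h : ContDiff ℝ ∞ fun _ : ℝ => r := contDiff_const
    exact h

theorem contDiff_pullback (f : smoothCircle) : ContDiff ℝ ∞ (pullback f.1) := f.2

theorem pullback_periodic (f : C(UnitAddCircle, ℂ)) : Function.Periodic (pullback f) 1 := by
  intro x
  simp [pullback]

theorem deriv_pullback_periodic (f : C(UnitAddCircle, ℂ)) :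
    Function.Periodic (fun x => (2 * Real.pi * Complex.I)⁻¹ * deriv (pullback f) x) 1 := by
  intro x
  have h : (fun y => pullback f (y + 1)) = pullback f := funext (pullback_periodic f)
  have h2 := deriv_comp_add_const (pullback f) 1 x
  rw [h] at h2
  simp only [← h2]

theorem contDiff_deriv_pullback {f : C(UnitAddCircle, ℂ)} (hf : f ∈ smoothCircle) :
    ContDiff ℝ ∞ (fun x => (2 * Real.pi * Complex.I)⁻¹ * deriv (pullback f) x) := by
  have h : ContDiff ℝ ∞ (deriv (pullback f)) := (contDiff_infty_iff_deriv.1 hf).2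
  exact contDiff_const.mul h

/-- The differential operator `(1 / 2πi) d/dx` on `C^∞(ℝ/ℤ)`. -/
def circleDeriv : smoothCircle →ₗ[ℂ] smoothCircle where
  toFun f :=
    ⟨⟨(deriv_pullback_periodic f.1).lift,
        continuous_coinduced_dom.2 (contDiff_deriv_pullback f.2).continuous⟩,
      contDiff_deriv_pullback f.2⟩
  map_add' f g := by
    ext x
    induction x using QuotientAddGroup.induction_on with
    | H x =>
    have hf := ((contDiff_pullback f).differentiable (by simp)) x
    have hg := ((contDiff_pullback g).differentiable (by simp)) x
    change _ * deriv (pullback f.1 + pullback g.1) x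
      = _ * deriv (pullback f.1) x + _ * deriv (pullback g.1) x
    rw [deriv_add hf hg, mul_add]
  map_smul' r f := by
    ext x
    induction x using QuotientAddGroup.induction_on with
    | H x =>
    have hf := ((contDiff_pullback f).differentiable (by simp)) x
    change _ * deriv (r • pullback f.1) x = r * (_ * deriv (pullback f.1) x)
    rw [deriv_const_smul r hf, smul_eq_mul]
    ring

theorem circleDeriv_coe (f : smoothCircle) (x : ℝ) :
    (circleDeriv f).1 (x : UnitAddCircle) =
      (2 * Real.pi * Complex.I)⁻¹ * deriv (pullback f.1) x := rfl

/-- The norm `‖f‖_{C^l} = ∑_{j ≤ l} (l choose j) ‖((1 / 2πi) d/dx)^j f‖_∞`. -/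
def circleNorm (l : ℕ) (f : smoothCircle) : ℝ :=
  ∑ j ∈ Finset.range (l + 1), (l.choose j : ℝ) * ‖((circleDeriv ^ j) f).1‖

/-- The part `f_+ = ∑_{n ≥ 0} f_n e^{2πinx}` of `f`. -/
def nonnegFreqPart (f : smoothCircle) : C(UnitAddCircle, ℂ) :=
  ∑' n : ℕ, fourierCoeff f.1 (n : ℤ) • fourier (n : ℤ)

/-- The part `f_- = ∑_{n < 0} f_n e^{2πinx}` of `f`. -/
def negFreqPart (f : smoothCircle) : C(UnitAddCircle, ℂ) :=
  ∑' n : ℕ, fourierCoeff f.1 (-((n : ℤ) + 1)) • fourier (-((n : ℤ) + 1))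

theorem fourierCoeff_circleDeriv (f : smoothCircle) (n : ℤ) :
    fourierCoeff (circleDeriv f).1 n = n * fourierCoeff f.1 n := by
  rw [fourierCoeff_eq_intervalIntegral _ n 0, fourierCoeff_eq_intervalIntegral _ n 0]
  have hd : ∀ x : ℝ, HasDerivAt
      (fun x : ℝ => (fourier (-n) (x : UnitAddCircle) : ℂ) * pullback f.1 x)
      ((2 * Real.pi * Complex.I) * ((fourier (-n) (x : UnitAddCircle) : ℂ) *
        (circleDeriv f).1 (x : UnitAddCircle) - n * ((fourier (-n) (x : UnitAddCircle) : ℂ) *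
        f.1 (x : UnitAddCircle)))) x := by
    intro x
    have hf := (((contDiff_pullback f).differentiable (by simp)) x).hasDerivAt
    have := (hasDerivAt_fourier_neg 1 n x).mul hf
    refine HasDerivAt.congr_deriv this ?_
    rw [circleDeriv_coe]
    have : (2 * Real.pi * Complex.I) ≠ 0 := Complex.two_pi_I_ne_zero
    field_simp
    simp [pullback]
    ring
  have hc1 : Continuous fun x : ℝ => (fourier (-n) (x : UnitAddCircle) : ℂ) *
      (circleDeriv f).1 (x : UnitAddCircle) :=
    ((fourier (-n)).continuous.comp (AddCircle.continuous_mk' 1)).mul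
      ((circleDeriv f).1.continuous.comp (AddCircle.continuous_mk' 1))
  have hc2 : Continuous fun x : ℝ => (fourier (-n) (x : UnitAddCircle) : ℂ) *
      f.1 (x : UnitAddCircle) :=
    ((fourier (-n)).continuous.comp (AddCircle.continuous_mk' 1)).mul
      (f.1.continuous.comp (AddCircle.continuous_mk' 1))
  have hc3 : Continuous fun x : ℝ => (n : ℂ) * ((fourier (-n) (x : UnitAddCircle) : ℂ) *
      f.1 (x : UnitAddCircle)) := continuous_const.mul hc2
  have key := intervalIntegral.integral_eq_sub_of_hasDerivAt (a := 0) (b := 0 + 1)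
    (fun x _ => hd x) ((continuous_const.mul (hc1.sub (continuous_const.mul hc2))).intervalIntegrable _ _)
  have hz : (fourier (-n) ((0 + 1 : ℝ) : UnitAddCircle) : ℂ) * pullback f.1 (0 + 1) -
      (fourier (-n) ((0 : ℝ) : UnitAddCircle) : ℂ) * pullback f.1 0 = 0 := by
    rw [pullback_periodic f.1 0, AddCircle.coe_add, AddCircle.coe_period, add_zero, sub_self]
  rw [hz, intervalIntegral.integral_const_mul, intervalIntegral.integral_sub
    (hc1.intervalIntegrable _ _) (hc3.intervalIntegrable _ _),
    intervalIntegral.integral_const_mul] at key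
  have h0 := (mul_eq_zero.1 key).resolve_left Complex.two_pi_I_ne_zero
  simpa using sub_eq_zero.1 h0

theorem norm_fourierCoeff_le (f : C(UnitAddCircle, ℂ)) (n : ℤ) : ‖fourierCoeff f n‖ ≤ ‖f‖ := by
  rw [fourierCoeff]
  refine (norm_integral_le_of_norm_le_const (C := ‖f‖) (Filter.Eventually.of_forall ?_)).trans ?_
  · intro t
    rw [norm_smul, fourier_apply, Circle.norm_coe, one_mul]
    exact f.norm_coe_le_norm t
  · simp

theorem fourierCoeff_rapid (f : smoothCircle) (N : ℕ) :
    ∃ C : ℝ, 0 ≤ C ∧ ∀ n : ℤ, ‖fourierCoeff f.1 n‖ * (1 + |(n : ℝ)|) ^ N ≤ C := by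
  have hpow : ∀ (N : ℕ) (n : ℤ),
      fourierCoeff ((circleDeriv ^ N) f).1 n = (n : ℂ) ^ N * fourierCoeff f.1 n := by
    intro N n
    induction N with
    | zero => simp
    | succ N ih =>
      rw [pow_succ', Module.End.mul_apply, fourierCoeff_circleDeriv, ih]
      ring
  refine ⟨2 ^ N * (‖f.1‖ + ‖((circleDeriv ^ N) f).1‖), by positivity, fun n => ?_⟩
  have h1 := norm_fourierCoeff_le f.1 n
  have h2 := norm_fourierCoeff_le ((circleDeriv ^ N) f).1 n
  rw [hpow, norm_mul, norm_pow, Complex.norm_intCast] at h2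
  have h3 : (1 + |(n : ℝ)|) ^ N ≤ 2 ^ N * (1 + |(n : ℝ)| ^ N) := by
    rcases le_total 1 |(n : ℝ)| with h | h
    · calc (1 + |(n : ℝ)|) ^ N ≤ (2 * |(n : ℝ)|) ^ N := by gcongr; linarith
        _ = 2 ^ N * |(n : ℝ)| ^ N := mul_pow _ _ _
        _ ≤ _ := by gcongr; linarith
    · calc (1 + |(n : ℝ)|) ^ N ≤ 2 ^ N := by gcongr; linarith
        _ ≤ _ := le_mul_of_one_le_right (by positivity) (by linarith [pow_nonneg (abs_nonneg (n : ℝ)) N])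
  calc ‖fourierCoeff f.1 n‖ * (1 + |(n : ℝ)|) ^ N
      ≤ ‖fourierCoeff f.1 n‖ * (2 ^ N * (1 + |(n : ℝ)| ^ N)) := by gcongr
    _ = 2 ^ N * (‖fourierCoeff f.1 n‖ + |(n : ℝ)| ^ N * ‖fourierCoeff f.1 n‖) := by ring
    _ ≤ _ := by gcongr

/-! ### Toeplitz operators -/

variable {H : Type*} [NormedAddCommGroup H] [InnerProductSpace ℂ H] [CompleteSpace H]

/-- The Hilbert space `L²(ℝ/ℤ)`. -/
abbrev L2Circle : Type := Lp ℂ 2 (AddCircle.haarAddCircle (T := (1 : ℝ)))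

/-- The operator of multiplication by `f` on `L²(ℝ/ℤ)`. -/
def mulOp (f : C(UnitAddCircle, ℂ)) : L2Circle →L[ℂ] L2Circle :=
  (ContinuousLinearMap.mul ℂ ℂ).holderL AddCircle.haarAddCircle ∞ 2 2
    (ContinuousMap.toLp ∞ AddCircle.haarAddCircle ℂ f)

/-- The isometric embedding of `H` in `L²(ℝ/ℤ)` that maps the basis vector `E k`, `k ≥ 0`, to
`e^{2πikx}`. -/
def hardyEmbedding (E : HilbertBasis ℕ ℂ H) : H →L[ℂ] L2Circle :=
  (((orthonormal_fourier (T := (1 : ℝ))).comp (fun n : ℕ => (n : ℤ))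
    Nat.cast_injective).orthogonalFamily.linearIsometry.comp
      E.repr.toLinearIsometry).toContinuousLinearMap

/-- The Toeplitz operator `T(f)`: the compression of the multiplication by `f` to `H`. -/
def toeplitz (E : HilbertBasis ℕ ℂ H) (f : C(UnitAddCircle, ℂ)) : H →L[ℂ] H :=
  adjoint (hardyEmbedding E) ∘L mulOp f ∘L hardyEmbedding E

theorem mulOp_toLp (f g : C(UnitAddCircle, ℂ)) :
    mulOp f (ContinuousMap.toLp 2 AddCircle.haarAddCircle ℂ g) =
      ContinuousMap.toLp 2 AddCircle.haarAddCircle ℂ (f * g) := by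
  apply Lp.ext
  have h1 := (ContinuousLinearMap.mul ℂ ℂ).coeFn_holder (r := 2)
    (ContinuousMap.toLp ∞ (AddCircle.haarAddCircle (T := (1 : ℝ))) ℂ f)
    (ContinuousMap.toLp 2 AddCircle.haarAddCircle ℂ g)
  have h2 := ContinuousMap.coeFn_toLp (p := ∞) (𝕜 := ℂ) (AddCircle.haarAddCircle (T := (1 : ℝ))) f
  have h3 := ContinuousMap.coeFn_toLp (p := 2) (𝕜 := ℂ) (AddCircle.haarAddCircle (T := (1 : ℝ))) g
  have h4 := ContinuousMap.coeFn_toLp (p := 2) (𝕜 := ℂ) (AddCircle.haarAddCircle (T := (1 : ℝ)))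
    (f * g)
  refine Filter.EventuallyEq.trans h1 ?_
  filter_upwards [h2, h3, h4] with x h2 h3 h4
  rw [h2, h3, h4]
  rfl

theorem hardyEmbedding_apply (E : HilbertBasis ℕ ℂ H) (k : ℕ) :
    hardyEmbedding E (E k) = fourierBasis (T := (1 : ℝ)) (k : ℤ) := by
  have h : hardyEmbedding E (E k) = ((orthonormal_fourier (T := (1 : ℝ))).comp
      (fun n : ℕ => (n : ℤ)) Nat.cast_injective).orthogonalFamily.linearIsometry
        (E.repr (E k)) := rfl
  rw [h, E.repr_self, OrthogonalFamily.linearIsometry_apply_single, coe_fourierBasis]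
  simp

/-- The matrix coefficients of an operator in the basis `E`. -/
def coef (E : HilbertBasis ℕ ℂ H) (a : H →L[ℂ] H) (k l : ℕ) : ℂ := inner ℂ (E k) (a (E l))

theorem inner_mulOp_toLp (f g : C(UnitAddCircle, ℂ)) (k : ℤ) :
    inner ℂ (fourierBasis (T := (1 : ℝ)) k)
      (mulOp f (ContinuousMap.toLp 2 AddCircle.haarAddCircle ℂ g)) = fourierCoeff (f * g : C(UnitAddCircle, ℂ)) k := by
  rw [mulOp_toLp, ← HilbertBasis.repr_apply_apply, fourierBasis_repr, fourierCoeff_toLp]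

theorem fourierCoeff_mul_fourier (f : C(UnitAddCircle, ℂ)) (k l : ℤ) :
    fourierCoeff (f * fourier l : C(UnitAddCircle, ℂ)) k = fourierCoeff f (k - l) := by
  simp only [fourierCoeff]
  congr 1
  ext x
  have : -(k - l) = -k + l := by ring
  rw [this, fourier_add]
  simp only [ContinuousMap.mul_apply, smul_eq_mul]
  ring

theorem inner_mulOp_fourierBasis (f : C(UnitAddCircle, ℂ)) (k l : ℤ) :
    inner ℂ (fourierBasis (T := (1 : ℝ)) k) (mulOp f (fourierBasis (T := (1 : ℝ)) l)) =
      fourierCoeff f (k - l) := by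
  have h : fourierBasis (T := (1 : ℝ)) l =
      ContinuousMap.toLp 2 AddCircle.haarAddCircle ℂ (fourier l) := by
    rw [coe_fourierBasis]
  rw [h]
  exact (inner_mulOp_toLp f (fourier l) k).trans (fourierCoeff_mul_fourier f k l)

theorem coef_toeplitz (E : HilbertBasis ℕ ℂ H) (f : C(UnitAddCircle, ℂ)) (k l : ℕ) :
    coef E (toeplitz E f) k l = fourierCoeff f ((k : ℤ) - l) := by
  simp only [coef, toeplitz, coe_comp, Function.comp_apply, adjoint_inner_right,
    hardyEmbedding_apply, inner_mulOp_fourierBasis]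

theorem coef_ext (E : HilbertBasis ℕ ℂ H) {a b : H →L[ℂ] H}
    (h : ∀ k l, coef E a k l = coef E b k l) : a = b := by
  have h1 : ∀ l, a (E l) = b (E l) := by
    intro l
    apply E.repr.injective
    ext k
    simpa [E.repr_apply_apply, coef] using h k l
  refine ContinuousLinearMap.ext_on ?_ (s := Set.range E) ?_
  · have := E.dense_span
    rw [← Submodule.dense_iff_topologicalClosure_eq_top] at this
    exact this
  · rintro _ ⟨l, rfl⟩
    exact h1 l

theorem toeplitz_add (E : HilbertBasis ℕ ℂ H) (f g : C(UnitAddCircle, ℂ)) :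
    toeplitz E (f + g) = toeplitz E f + toeplitz E g := by
  simp only [toeplitz, mulOp, map_add, add_comp, comp_add]

theorem toeplitz_algebraMap (E : HilbertBasis ℕ ℂ H) (r : ℂ) :
    toeplitz E (algebraMap ℂ C(UnitAddCircle, ℂ) r) = algebraMap ℂ (H →L[ℂ] H) r := by
  have h : (algebraMap ℂ C(UnitAddCircle, ℂ) r : UnitAddCircle → ℂ) =
      r • (fourier 0 : UnitAddCircle → ℂ) := by
    ext x
    simp
  apply coef_ext E
  intro k l
  rw [coef_toeplitz, h, fourierCoeff.const_smul, fourierCoeff_fourier, coef,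
    Algebra.algebraMap_eq_smul_one, smul_apply, one_apply_eq_self, inner_smul_right,
    orthonormal_iff_ite.1 E.orthonormal k l, smul_eq_mul]
  simp [Pi.single_apply, sub_eq_zero]

/-! ### Smooth compact operators -/

/-- A double sequence is rapidly decaying. -/
def RapidlyDecaying (c : ℕ → ℕ → ℂ) : Prop :=
  ∀ N : ℕ, ∃ C : ℝ, ∀ k l : ℕ, (1 + (k : ℝ) + l) ^ N * ‖c k l‖ ≤ C

/-- `a` is a smooth compact operator: `a = ∑ c_{k,l} P_{k,l}` with a rapidly decaying `c`, where
`P_{k,l} = ⟨E l, ·⟩ E k` are the matrix units of the basis `E`. -/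
def IsSmoothCompact (E : HilbertBasis ℕ ℂ H) (a : H →L[ℂ] H) : Prop :=
  ∃ c : ℕ → ℕ → ℂ, RapidlyDecaying c ∧
    HasSum (fun p : ℕ × ℕ => c p.1 p.2 • InnerProductSpace.rankOne ℂ (E p.1) (E p.2)) a

theorem rapidlyDecaying_iff (c : ℕ → ℕ → ℂ) : RapidlyDecaying c ↔
    ∀ N : ℕ, ∃ C : ℝ, ∀ k l : ℕ, ‖c k l‖ * ((1 + (k : ℝ)) ^ N * (1 + (l : ℝ)) ^ N) ≤ C := by
  constructor
  · intro h N
    obtain ⟨C, hC⟩ := h (N + N)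
    refine ⟨C, fun k l => le_trans ?_ (hC k l)⟩
    rw [mul_comm, pow_add]
    have hk : (0 : ℝ) ≤ k := k.cast_nonneg
    have hl : (0 : ℝ) ≤ l := l.cast_nonneg
    have h1 : 1 + (k : ℝ) ≤ 1 + k + l := by linarith
    have h2 : 1 + (l : ℝ) ≤ 1 + k + l := by linarith
    gcongr
  · intro h N
    obtain ⟨C, hC⟩ := h N
    refine ⟨C, fun k l => le_trans ?_ (hC k l)⟩
    rw [mul_comm, ← mul_pow]
    have hk : (0 : ℝ) ≤ k := k.cast_nonneg
    have hl : (0 : ℝ) ≤ l := l.cast_nonneg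
    gcongr
    nlinarith [mul_nonneg hk hl]

theorem coef_add (E : HilbertBasis ℕ ℂ H) (a b : H →L[ℂ] H) (k l : ℕ) :
    coef E (a + b) k l = coef E a k l + coef E b k l := by
  simp [coef]

theorem coef_sub (E : HilbertBasis ℕ ℂ H) (a b : H →L[ℂ] H) (k l : ℕ) :
    coef E (a - b) k l = coef E a k l - coef E b k l := by
  simp [coef]

theorem coef_of_hasSum (E : HilbertBasis ℕ ℂ H) {c : ℕ → ℕ → ℂ} {a : H →L[ℂ] H}
    (h : HasSum (fun p : ℕ × ℕ => c p.1 p.2 • InnerProductSpace.rankOne ℂ (E p.1) (E p.2)) a)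
    (k l : ℕ) : coef E a k l = c k l := by
  have h1 := ((innerSL ℂ (E k)).comp (ContinuousLinearMap.apply ℂ H (E l))).hasSum h
  have h2 : HasSum (fun p : ℕ × ℕ => if p = (k, l) then c k l else 0) (c k l) :=
    hasSum_ite_eq _ _
  refine h1.unique (h2.congr_fun ?_)
  rintro ⟨i, j⟩
  have hi := orthonormal_iff_ite.1 E.orthonormal k i
  have hj := orthonormal_iff_ite.1 E.orthonormal j l
  by_cases h1 : k = i <;> by_cases h3 : j = l
  all_goals simp [h1, h3, hi, hj, eq_comm]
  · simp [E.orthonormal.1]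
  · exact fun h4 => absurd h4.symm h3

theorem summable_inv_sq : Summable fun n : ℕ => ((1 + (n : ℝ)) ^ 2)⁻¹ := by
  have := (summable_nat_add_iff 1).2 (Real.summable_nat_pow_inv.2 one_lt_two)
  refine this.congr fun n => ?_
  push_cast
  rw [add_comm]

theorem isSmoothCompact_iff (E : HilbertBasis ℕ ℂ H) (a : H →L[ℂ] H) :
    IsSmoothCompact E a ↔ RapidlyDecaying (coef E a) := by
  constructor
  · rintro ⟨c, hc, h⟩
    have : coef E a = c := funext fun k => funext fun l => coef_of_hasSum E h k l
    rwa [this]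
  · intro hc
    refine ⟨coef E a, hc, ?_⟩
    have hs : Summable fun p : ℕ × ℕ =>
        coef E a p.1 p.2 • InnerProductSpace.rankOne ℂ (E p.1) (E p.2) := by
      obtain ⟨C, hC⟩ := (rapidlyDecaying_iff _).1 hc 2
      have h2 := (summable_inv_sq.mul_of_nonneg summable_inv_sq (fun n => by positivity) (fun n => by positivity)).mul_left C
      refine Summable.of_norm_bounded h2 fun p => ?_
      rw [norm_smul, InnerProductSpace.norm_rankOne, E.orthonormal.1, E.orthonormal.1, mul_one,
        mul_one, ← mul_inv, ← div_eq_mul_inv, le_div_iff₀ (by positivity)]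
      exact hC p.1 p.2
    have : a = ∑' p : ℕ × ℕ, coef E a p.1 p.2 • InnerProductSpace.rankOne ℂ (E p.1) (E p.2) :=
      coef_ext E fun k l => (coef_of_hasSum E hs.hasSum k l).symm
    nth_rewrite 2 [this]
    exact hs.hasSum

/-- A matrix is concentrated near its diagonal. -/
def Banded (c : ℕ → ℕ → ℂ) : Prop :=
  ∀ N : ℕ, ∃ C : ℝ, 0 ≤ C ∧ ∀ k l : ℕ, ‖c k l‖ * (1 + |(k : ℝ) - l|) ^ N ≤ C

theorem RapidlyDecaying.banded {c : ℕ → ℕ → ℂ} (h : RapidlyDecaying c) : Banded c := by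
  intro N
  obtain ⟨C, hC⟩ := h N
  refine ⟨C, le_trans (by positivity) (hC 0 0), fun k l => le_trans ?_ (hC k l)⟩
  rw [mul_comm]
  have hk : (0 : ℝ) ≤ k := k.cast_nonneg
  have hl : (0 : ℝ) ≤ l := l.cast_nonneg
  have : 1 + |(k : ℝ) - l| ≤ 1 + k + l := by
    rw [add_assoc]
    exact add_le_add le_rfl (abs_le.2 ⟨by linarith, by linarith⟩)
  gcongr

theorem RapidlyDecaying.swap {c : ℕ → ℕ → ℂ} (h : RapidlyDecaying c) :
    RapidlyDecaying fun k l => c l k := by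
  intro N
  obtain ⟨C, hC⟩ := h N
  refine ⟨C, fun k l => ?_⟩
  rw [add_right_comm]
  exact hC l k

theorem Banded.swap {c : ℕ → ℕ → ℂ} (h : Banded c) : Banded fun k l => c l k := by
  intro N
  obtain ⟨C, h0, hC⟩ := h N
  refine ⟨C, h0, fun k l => ?_⟩
  rw [abs_sub_comm]
  exact hC l k

theorem Banded.mul_rapidlyDecaying {α β : ℕ → ℕ → ℂ} (hα : Banded α) (hβ : RapidlyDecaying β) :
    RapidlyDecaying fun k l => ∑' j, α k j * β j l := by
  rw [rapidlyDecaying_iff] at hβ ⊢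
  intro N
  obtain ⟨A, hA0, hA⟩ := hα N
  obtain ⟨B, hB⟩ := hβ (N + 2)
  refine ⟨A * B * ∑' n : ℕ, ((1 + (n : ℝ)) ^ 2)⁻¹, fun k l => ?_⟩
  have hkl : 0 < (1 + (k : ℝ)) ^ N * (1 + (l : ℝ)) ^ N := by positivity
  rw [← le_div_iff₀ hkl]
  have hs := (summable_inv_sq.hasSum.mul_left (A * B)).div_const
    ((1 + (k : ℝ)) ^ N * (1 + (l : ℝ)) ^ N)
  refine tsum_of_norm_bounded hs fun j => ?_
  rw [le_div_iff₀ hkl, ← div_eq_mul_inv, le_div_iff₀ (by positivity), norm_mul]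
  have h1 := hA k j
  have h2 := hB j l
  have hj : (0 : ℝ) ≤ j := j.cast_nonneg
  have hl : (0 : ℝ) ≤ l := l.cast_nonneg
  have h3 : 1 + (k : ℝ) ≤ (1 + |(k : ℝ) - j|) * (1 + j) := by
    have := le_abs_self ((k : ℝ) - j)
    nlinarith [mul_nonneg (abs_nonneg ((k : ℝ) - j)) hj]
  calc ‖α k j‖ * ‖β j l‖ * ((1 + (k : ℝ)) ^ N * (1 + (l : ℝ)) ^ N) * (1 + (j : ℝ)) ^ 2
      ≤ ‖α k j‖ * ‖β j l‖ * (((1 + |(k : ℝ) - j|) * (1 + j)) ^ N * (1 + (l : ℝ)) ^ (N + 2))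
          * (1 + (j : ℝ)) ^ 2 := by
        gcongr
        · linarith
        · omega
    _ = (‖α k j‖ * (1 + |(k : ℝ) - j|) ^ N) *
          (‖β j l‖ * ((1 + (j : ℝ)) ^ (N + 2) * (1 + (l : ℝ)) ^ (N + 2))) := by
        rw [mul_pow]
        ring
    _ ≤ A * B := by gcongr

theorem hasSum_coef_mul (E : HilbertBasis ℕ ℂ H) (a b : H →L[ℂ] H) (k l : ℕ) :
    HasSum (fun j => coef E a k j * coef E b j l) (coef E (a * b) k l) := by
  have := E.hasSum_inner_mul_inner (adjoint a (E k)) (b (E l))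
  simp only [adjoint_inner_left] at this
  exact this

theorem IsSmoothCompact.add {E : HilbertBasis ℕ ℂ H} {a b : H →L[ℂ] H}
    (ha : IsSmoothCompact E a) (hb : IsSmoothCompact E b) : IsSmoothCompact E (a + b) := by
  rw [isSmoothCompact_iff] at *
  intro N
  obtain ⟨A, hA⟩ := ha N
  obtain ⟨B, hB⟩ := hb N
  refine ⟨A + B, fun k l => ?_⟩
  rw [coef_add]
  calc (1 + (k : ℝ) + l) ^ N * ‖coef E a k l + coef E b k l‖
      ≤ (1 + (k : ℝ) + l) ^ N * (‖coef E a k l‖ + ‖coef E b k l‖) := by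
        gcongr
        exact norm_add_le _ _
    _ ≤ A + B := by
        rw [mul_add]
        exact add_le_add (hA k l) (hB k l)

theorem IsSmoothCompact.left_mul {E : HilbertBasis ℕ ℂ H} {a b : H →L[ℂ] H}
    (ha : Banded (coef E a)) (hb : IsSmoothCompact E b) : IsSmoothCompact E (a * b) := by
  rw [isSmoothCompact_iff] at *
  convert ha.mul_rapidlyDecaying hb using 3
  exact (hasSum_coef_mul E a b _ _).tsum_eq.symm

theorem IsSmoothCompact.right_mul {E : HilbertBasis ℕ ℂ H} {a b : H →L[ℂ] H}
    (hb : IsSmoothCompact E b) (ha : Banded (coef E a)) : IsSmoothCompact E (b * a) := by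
  rw [isSmoothCompact_iff] at *
  convert (ha.swap.mul_rapidlyDecaying hb.swap).swap using 3
  rw [← (hasSum_coef_mul E b a _ _).tsum_eq]
  simp only [mul_comm]

theorem banded_toeplitz (E : HilbertBasis ℕ ℂ H) (f : smoothCircle) :
    Banded (coef E (toeplitz E f.1)) := by
  intro N
  obtain ⟨C, h0, hC⟩ := fourierCoeff_rapid f N
  refine ⟨C, h0, fun k l => ?_⟩
  have := hC ((k : ℤ) - l)
  rw [coef_toeplitz]
  simpa using this

theorem coef_toeplitz_mul_sub (E : HilbertBasis ℕ ℂ H) (f g : C(UnitAddCircle, ℂ)) (k l : ℕ) :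
    coef E (toeplitz E f * toeplitz E g - toeplitz E (f * g)) k l =
      -∑' j : ℕ, fourierCoeff f ((k : ℤ) + (j + 1)) * fourierCoeff g (-((j : ℤ) + 1) - l) := by
  have h1 : HasSum (fun j : ℤ => fourierCoeff f (k - j) * fourierCoeff g (j - l))
      (fourierCoeff (f * g : C(UnitAddCircle, ℂ)) ((k : ℤ) - l)) := by
    have := (fourierBasis (T := (1 : ℝ))).hasSum_inner_mul_inner
      (adjoint (mulOp f) (fourierBasis (T := (1 : ℝ)) (k : ℤ)))
      (mulOp g (fourierBasis (T := (1 : ℝ)) (l : ℤ)))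
    simp only [adjoint_inner_left, inner_mulOp_fourierBasis] at this
    have h : fourierBasis (T := (1 : ℝ)) (l : ℤ) =
        ContinuousMap.toLp 2 AddCircle.haarAddCircle ℂ (fourier (l : ℤ)) := by
      rw [coe_fourierBasis]
    have h' : inner ℂ (fourierBasis (T := (1 : ℝ)) (k : ℤ))
        (mulOp f (mulOp g (fourierBasis (T := (1 : ℝ)) (l : ℤ)))) =
          fourierCoeff (f * g : C(UnitAddCircle, ℂ)) ((k : ℤ) - l) := by
      rw [h, mulOp_toLp, inner_mulOp_toLp, ← mul_assoc, fourierCoeff_mul_fourier]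
    rw [h'] at this
    exact this
  have h2 := hasSum_coef_mul E (toeplitz E f) (toeplitz E g) k l
  simp only [coef_toeplitz] at h2
  have h3 : Summable fun j : ℕ => fourierCoeff f ((k : ℤ) - (-((j : ℤ) + 1))) *
      fourierCoeff g (-((j : ℤ) + 1) - l) :=
    h1.summable.comp_injective (i := fun j : ℕ => -((j : ℤ) + 1)) fun a b h => by
      simpa using h
  have h4 := h1.unique (HasSum.of_nat_of_neg_add_one h2 h3.hasSum)
  rw [coef_sub, coef_toeplitz, h4, sub_add_cancel_left]
  simp only [sub_neg_eq_add]

theorem isSmoothCompact_toeplitz_mul_sub (E : HilbertBasis ℕ ℂ H) (f g : smoothCircle) :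
    IsSmoothCompact E (toeplitz E f.1 * toeplitz E g.1 - toeplitz E (f.1 * g.1)) := by
  rw [isSmoothCompact_iff, rapidlyDecaying_iff]
  intro N
  obtain ⟨A, hA0, hA⟩ := fourierCoeff_rapid f N
  obtain ⟨B, hB0, hB⟩ := fourierCoeff_rapid g (N + 2)
  refine ⟨A * B * ∑' n : ℕ, ((1 + (n : ℝ)) ^ 2)⁻¹, fun k l => ?_⟩
  have hkl : 0 < (1 + (k : ℝ)) ^ N * (1 + (l : ℝ)) ^ N := by positivity
  rw [← le_div_iff₀ hkl, coef_toeplitz_mul_sub, norm_neg]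
  have hs := (summable_inv_sq.hasSum.mul_left (A * B)).div_const
    ((1 + (k : ℝ)) ^ N * (1 + (l : ℝ)) ^ N)
  refine tsum_of_norm_bounded hs fun j => ?_
  rw [le_div_iff₀ hkl, ← div_eq_mul_inv, le_div_iff₀ (by positivity), norm_mul]
  have h1 := hA ((k : ℤ) + (j + 1))
  have h2 := hB (-((j : ℤ) + 1) - l)
  push_cast at h1 h2
  have hj : (0 : ℝ) ≤ j := j.cast_nonneg
  have hl : (0 : ℝ) ≤ l := l.cast_nonneg
  have hk : (0 : ℝ) ≤ k := k.cast_nonneg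
  rw [abs_of_nonneg (by linarith)] at h1
  rw [abs_of_nonpos (by linarith)] at h2
  have e1 : 1 + (k : ℝ) ≤ 1 + ((k : ℝ) + (j + 1)) := by linarith
  have e2 : 1 + (l : ℝ) ≤ 1 + -(-((j : ℝ) + 1) - l) := by linarith
  have e3 : 1 + (j : ℝ) ≤ 1 + -(-((j : ℝ) + 1) - l) := by linarith
  have e4 : (1 + (l : ℝ)) ^ N * (1 + (j : ℝ)) ^ 2 ≤ (1 + -(-((j : ℝ) + 1) - l)) ^ (N + 2) := by
    rw [pow_add]
    have : (0 : ℝ) ≤ 1 + -(-((j : ℝ) + 1) - l) := by linarith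
    gcongr
  calc ‖fourierCoeff f.1 ((k : ℤ) + (j + 1))‖ * ‖fourierCoeff g.1 (-((j : ℤ) + 1) - l)‖ *
        ((1 + (k : ℝ)) ^ N * (1 + (l : ℝ)) ^ N) * (1 + (j : ℝ)) ^ 2
      = (‖fourierCoeff f.1 ((k : ℤ) + (j + 1))‖ * (1 + (k : ℝ)) ^ N) *
        (‖fourierCoeff g.1 (-((j : ℤ) + 1) - l)‖ * ((1 + (l : ℝ)) ^ N * (1 + (j : ℝ)) ^ 2)) := by
        ring
    _ ≤ A * B := by
        refine mul_le_mul (le_trans ?_ h1) (le_trans ?_ h2) (by positivity) hA0 <;> gcongr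

/-- The space `𝒦^∞` of smooth compact operators. -/
def smoothCompact (E : HilbertBasis ℕ ℂ H) : Submodule ℂ (H →L[ℂ] H) where
  carrier := {a | IsSmoothCompact E a}
  add_mem' ha hb := IsSmoothCompact.add ha hb
  zero_mem' := ⟨0, fun N => ⟨0, by simp⟩, by simp⟩
  smul_mem' r a := by
    rintro ⟨c, hc, h⟩
    refine ⟨fun k l => r * c k l, fun N => ?_, ?_⟩
    · obtain ⟨C, hC⟩ := hc N
      refine ⟨‖r‖ * C, fun k l => ?_⟩
      rw [norm_mul, mul_left_comm]
      exact mul_le_mul_of_nonneg_left (hC k l) (norm_nonneg r)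
    · simpa only [mul_smul] using h.const_smul r

/-- The smooth Toeplitz algebra `𝒯^∞ = {T(f) + c : f ∈ C^∞(ℝ/ℤ), c ∈ 𝒦^∞}`. -/
def smoothToeplitz (E : HilbertBasis ℕ ℂ H) : Subalgebra ℂ (H →L[ℂ] H) where
  carrier := {a | ∃ f ∈ smoothCircle, ∃ c ∈ smoothCompact E, a = toeplitz E f + c}
  mul_mem' := by
    rintro _ _ ⟨f, hf, c, hc, rfl⟩ ⟨g, hg, d, hd, rfl⟩
    have hT := banded_toeplitz E ⟨f, hf⟩
    have hS := banded_toeplitz E ⟨g, hg⟩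
    have hc' : Banded (coef E c) := ((isSmoothCompact_iff E c).1 hc).banded
    refine ⟨f * g, mul_mem hf hg, (toeplitz E f * toeplitz E g - toeplitz E (f * g)) +
      (toeplitz E f * d + c * toeplitz E g + c * d), ?_, ?_⟩
    · exact (isSmoothCompact_toeplitz_mul_sub E ⟨f, hf⟩ ⟨g, hg⟩).add
        (((IsSmoothCompact.left_mul hT hd).add (IsSmoothCompact.right_mul hc hS)).add
          (IsSmoothCompact.left_mul hc' hd))
    · noncomm_ring
  add_mem' := by
    rintro _ _ ⟨f, hf, c, hc, rfl⟩ ⟨g, hg, d, hd, rfl⟩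
    refine ⟨f + g, add_mem hf hg, c + d, add_mem hc hd, ?_⟩
    rw [toeplitz_add]
    abel
  algebraMap_mem' r :=
    ⟨algebraMap ℂ _ r, smoothCircle.algebraMap_mem r, 0, zero_mem _, by
      rw [toeplitz_algebraMap, add_zero]⟩

/-! ### The Fréchet topology of the smooth Toeplitz algebra -/

/-- The operator norm, in `[0, ∞]`, of the operator with matrix `m`; it is `∞` if no bounded
operator has this matrix. -/
def matrixNorm (E : HilbertBasis ℕ ℂ H) (m : ℕ → ℕ → ℂ) : ℝ≥0∞ :=
  ⨅ (b : H →L[ℂ] H) (_ : ∀ k l, coef E b k l = m k l), ‖b‖ₑ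

/-- The norm `‖a‖_{M,N} = ∑_{j ≤ M} (M choose j) ‖δ_𝕂^j(a) (1 + 𝕂)^N‖`, where `𝕂 E k = k E k`
and `δ_𝕂(a) = [𝕂, a]`; the operator `δ_𝕂^j(a) (1 + 𝕂)^N` has the matrix
`(k - l)^j (1 + l)^N a_{k,l}`. -/
def compactNorm (E : HilbertBasis ℕ ℂ H) (M N : ℕ) (a : H →L[ℂ] H) : ℝ≥0∞ :=
  ∑ j ∈ Finset.range (M + 1), (M.choose j : ℝ≥0∞) *
    matrixNorm E fun k l => ((k : ℂ) - l) ^ j * (1 + (l : ℂ)) ^ N * coef E a k l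

/-- The norm `‖T(f) + c‖_{M,N} = S ‖f‖_{C^{M+N+2}} + ‖c‖_{M,N}` on `𝒯^∞`, with the constant
`S = 1/2 + √((4π² - 9)/12)`. The decomposition `T(f) + c` of an element of `𝒯^∞` is unique, so that
the infimum is over a single pair `(f, c)`. -/
def toeplitzNorm (E : HilbertBasis ℕ ℂ H) (M N : ℕ) (a : smoothToeplitz E) : ℝ≥0∞ :=
  ⨅ (f : smoothCircle) (c : smoothCompact E) (_ : (a : H →L[ℂ] H) = toeplitz E f.1 + c),
    ENNReal.ofReal ((1 / 2 + Real.sqrt ((4 * Real.pi ^ 2 - 9) / 12)) *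
      circleNorm (M + N + 2) f) + compactNorm E M N c

/-- The topology of `𝒯^∞` defined by the norms `‖·‖_{M,N}`: it is generated by their open balls. -/
@[reducible] def frechetTopology (E : HilbertBasis ℕ ℂ H) : TopologicalSpace (smoothToeplitz E) :=
  TopologicalSpace.generateFrom
    {s | ∃ (M N : ℕ) (a : smoothToeplitz E) (ε : ℝ≥0∞), 0 < ε ∧
      s = {b | toeplitzNorm E M N (b - a) < ε}}

/-- Continuity of a linear map `𝒯^∞ → 𝒯^∞` in the Fréchet topology (not in the operator norm). -/
def IsFrechetContinuous (E : HilbertBasis ℕ ℂ H)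
    (δ : smoothToeplitz E →ₗ[ℂ] smoothToeplitz E) : Prop :=
  Continuous[frechetTopology E, frechetTopology E] δ

/-! ### Derivations -/

/-- The Leibniz rule. -/
def IsDerivation (E : HilbertBasis ℕ ℂ H) (δ : smoothToeplitz E →ₗ[ℂ] smoothToeplitz E) : Prop :=
  ∀ a b, δ (a * b) = a * δ b + δ a * b

/-- `δ` is the commutator with an element of `𝒯^∞`. -/
def IsInnerDerivation (E : HilbertBasis ℕ ℂ H)
    (δ : smoothToeplitz E →ₗ[ℂ] smoothToeplitz E) : Prop :=
  ∃ α : smoothToeplitz E, ∀ a, δ a = α * a - a * α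

/-- The domain of the unbounded operator `𝕂`: the vectors `x = ∑ x_k E k` with
`∑ |k x_k|² < ∞`. -/
def numberDomain (E : HilbertBasis ℕ ℂ H) : Submodule ℂ H where
  carrier := {x | Memℓp (fun k : ℕ => (k : ℂ) * E.repr x k) 2}
  zero_mem' := by
    have h : (fun k : ℕ => (k : ℂ) * E.repr (0 : H) k) = (0 : ℕ → ℂ) := by
      ext k
      simp
    rw [Set.mem_ofPred_eq, h]
    exact zero_memℓp
  add_mem' := by
    intro x y hx hy
    have h : (fun k : ℕ => (k : ℂ) * E.repr (x + y) k) =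
        (fun k : ℕ => (k : ℂ) * E.repr x k) + fun k : ℕ => (k : ℂ) * E.repr y k := by
      ext k
      simp [mul_add]
    rw [Set.mem_ofPred_eq, h]
    exact Memℓp.add hx hy
  smul_mem' := by
    intro r x hx
    have h : (fun k : ℕ => (k : ℂ) * E.repr (r • x) k) =
        r • fun k : ℕ => (k : ℂ) * E.repr x k := by
      ext k
      simp [mul_left_comm]
    rw [Set.mem_ofPred_eq, h]
    exact Memℓp.const_smul hx r

/-- The unbounded diagonal operator `𝕂 E k = k E k`, on its maximal domain. -/
def numberOp (E : HilbertBasis ℕ ℂ H) : H →ₗ.[ℂ] H where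
  domain := numberDomain E
  toFun :=
    { toFun := fun x => E.repr.symm ⟨fun k : ℕ => (k : ℂ) * E.repr (x : H) k, x.2⟩
      map_add' := by
        intro x y
        rw [← map_add]
        congr 1
        ext k
        simp only [Submodule.coe_add, map_add, lp.coeFn_add, Pi.add_apply]
        exact mul_add _ _ _
      map_smul' := by
        intro r x
        rw [← map_smul]
        congr 1
        ext k
        simp only [Submodule.coe_smul, map_smul, lp.coeFn_smul, Pi.smul_apply, smul_eq_mul,
          RingHom.id_apply]
        exact mul_left_comm _ _ _ }

/-- The composition `x ↦ D (t x)` of a bounded operator `t` and an unbounded operator `D`, with the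
domain `{x | t x ∈ dom D}`. -/
def compBounded (D : H →ₗ.[ℂ] H) (t : H →L[ℂ] H) : H →ₗ.[ℂ] H where
  domain := D.domain.comap (t : H →ₗ[ℂ] H)
  toFun := D.toFun ∘ₗ (t : H →ₗ[ℂ] H).restrict fun _ hx => hx

/-- The unbounded operator `T(F_+) 𝕂 + 𝕂 T(F_-)`. -/
def vectorFieldOp (E : HilbertBasis ℕ ℂ H) (F : smoothCircle) : H →ₗ.[ℂ] H :=
  (toeplitz E (nonnegFreqPart F) : H →ₗ[ℂ] H).compPMap (numberOp E) +
    compBounded (numberOp E) (toeplitz E (negFreqPart F))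

/-- `δ` is the map `δ_F(a) = [T(F_+) 𝕂 + 𝕂 T(F_-), a]`: every `a ∈ 𝒯^∞` preserves the domain of
`D = T(F_+) 𝕂 + 𝕂 T(F_-)`, and the bounded operator `δ(a)` is equal to `D a - a D` there. -/
def IsDeltaF (E : HilbertBasis ℕ ℂ H) (F : smoothCircle)
    (δ : smoothToeplitz E →ₗ[ℂ] smoothToeplitz E) : Prop :=
  ∀ (a : smoothToeplitz E) (x : (vectorFieldOp E F).domain),
    ∃ h : a.1 (x : H) ∈ (vectorFieldOp E F).domain,
      (δ a).1 (x : H) = vectorFieldOp E F ⟨a.1 x, h⟩ - a.1 (vectorFieldOp E F x)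

/-- `q(a) = f` for the quotient map `q : 𝒯^∞ → 𝒯^∞ / 𝒦^∞ ≅ C^∞(ℝ/ℤ)`, `T(f) + c ↦ f`. -/
def HasSymbol (E : HilbertBasis ℕ ℂ H) (a : smoothToeplitz E) (f : smoothCircle) : Prop :=
  ∃ c ∈ smoothCompact E, (a : H →L[ℂ] H) = toeplitz E f.1 + c

end QuantumDisk

end

open QuantumDisk

/-! Everything is read off from matrix entries in the basis `E`. An operator `T(f) + c` of the
algebra is a matrix whose diagonals are constant, with values the rapidly decaying coefficients
`f_n`, up to a matrix that decays in both indices. Conversely, every such matrix comes from an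
element of the algebra. Products stay in the algebra because the defect `T(f)T(g) - T(fg)` only
involves frequencies beyond `k` and `l`.

Existence of `δ_F`: since `[𝕂, T(F_-)]` is the Toeplitz operator of the derivative of `F_-`, the
operator `T(F_+)𝕂 + 𝕂T(F_-)` is `T(F)𝕂` plus an element of the algebra, with the domain of `𝕂`.
Hence `δ_F(a) = T(F)[𝕂, a] + [T(F), a]𝕂 + [[𝕂, T(F_-)], a]`. The commutator `[T(F), a]` has a
rapidly decaying matrix, which absorbs the factor `𝕂`; only the first term contributes to the
symbol.

Classification: let `U = T(e^{2πix})` and let `g` be the symbol of `δ(U)`. As `δ_F(U)` has symbol `F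
e^{2πix}`, the choice `F = g e^{-2πix}` makes `(δ - δ_F)(U)` smooth compact. It remains to see that
a derivation `δ` with `δ(U)` smooth compact is inner (`IsDerivation.exists_eq_commutator`). Put
`L_{k,l} = ⟨E_k, δ(P_{l,0}) E_0⟩`. The identity `P_{0,k} a P_{l,0} = a_{k,l} P_{0,0}` and the
Leibniz rule give `δ(a) = [L, a]` entry by entry, with no continuity assumed. The relation `U
P_{l,0} = P_{l+1,0}` says that the increments of `L` along its diagonals are the entries
`δ(U)_{k+1,l}`. So `L` converges rapidly along each diagonal: it is a Toeplitz matrix plus a rapidly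
decaying one (`exists_coef_eq_of_diagonal`).

Continuity is a consequence: `δ_F` and commutators satisfy explicit weighted estimates (`IsTame`),
and the weighted bounds are equivalent to the Fréchet norms. Uniqueness of `F` follows by comparing
symbols at `U`. -/

noncomputable section

namespace QuantumDisk

open MeasureTheory ContinuousLinearMap
open scoped ENNReal ContDiff Topology InnerProductSpace

set_option linter.unusedSectionVars false

variable {H : Type*} [NormedAddCommGroup H] [InnerProductSpace ℂ H] [CompleteSpace H]

/-! ### Fourier series with rapidly decaying coefficients -/

/-- The sequence `β` satisfies `|β n| (1 + |n|)^N ≤ A`. -/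
def FourierBound (β : ℤ → ℂ) (N : ℕ) (A : ℝ) : Prop :=
  ∀ n : ℤ, ‖β n‖ * (1 + |(n : ℝ)|) ^ N ≤ A

theorem FourierBound.nonneg {β : ℤ → ℂ} {N : ℕ} {A : ℝ} (h : FourierBound β N A) : 0 ≤ A :=
  le_trans (by positivity) (h 0)

theorem FourierBound.mono {β : ℤ → ℂ} {M N : ℕ} {A B : ℝ} (h : FourierBound β N A) (hM : M ≤ N)
    (hA : A ≤ B) : FourierBound β M B := fun n => by
  refine le_trans ?_ ((h n).trans hA)
  gcongr
  linarith [abs_nonneg (n : ℝ)]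

theorem FourierBound.add {β γ : ℤ → ℂ} {N : ℕ} {A B : ℝ} (hβ : FourierBound β N A)
    (hγ : FourierBound γ N B) : FourierBound (fun n => β n + γ n) N (A + B) := fun n => by
  calc ‖β n + γ n‖ * (1 + |(n : ℝ)|) ^ N ≤ (‖β n‖ + ‖γ n‖) * (1 + |(n : ℝ)|) ^ N := by
        gcongr
        exact norm_add_le _ _
    _ ≤ A + B := by linarith [hβ n, hγ n]

theorem summable_int_inv_sq : Summable fun n : ℤ => ((1 + |(n : ℝ)|) ^ 2)⁻¹ := by
  refine Summable.of_nat_of_neg ?_ ?_ <;>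
  · refine summable_inv_sq.congr fun n => ?_
    simp

theorem FourierBound.norm_le {β : ℤ → ℂ} {A : ℝ} (h : FourierBound β 2 A) (n : ℤ) :
    ‖β n‖ ≤ A * ((1 + |(n : ℝ)|) ^ 2)⁻¹ := by
  rw [← div_eq_mul_inv, le_div_iff₀ (by positivity)]
  exact h n

theorem FourierBound.summable {β : ℤ → ℂ} {A : ℝ} (h : FourierBound β 2 A) :
    Summable fun n => ‖β n‖ :=
  Summable.of_nonneg_of_le (fun _ => norm_nonneg _) h.norm_le (summable_int_inv_sq.mul_left A)

theorem FourierBound.intCast_mul {β : ℤ → ℂ} {N : ℕ} {A : ℝ} (h : FourierBound β (N + 1) A) :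
    FourierBound (fun n : ℤ => n * β n) N A := fun n => by
  refine le_trans ?_ (h n)
  rw [norm_mul, Complex.norm_intCast, pow_succ]
  have : |(n : ℝ)| ≤ 1 + |(n : ℝ)| := by linarith
  calc |(n : ℝ)| * ‖β n‖ * (1 + |(n : ℝ)|) ^ N
      ≤ (1 + |(n : ℝ)|) * ‖β n‖ * (1 + |(n : ℝ)|) ^ N := by gcongr
    _ = _ := by ring

theorem norm_fourier_term (z : ℂ) (n : ℤ) (x : ℝ) :
    ‖z * fourier n (x : UnitAddCircle)‖ = ‖z‖ := by
  rw [norm_mul, fourier_apply, Circle.norm_coe, mul_one]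

theorem hasDerivAt_tsum_fourier {β : ℤ → ℂ} (h : ∀ N, ∃ A, FourierBound β N A) (x : ℝ) :
    HasDerivAt (fun x : ℝ => ∑' n : ℤ, β n * fourier n (x : UnitAddCircle))
      ((2 * Real.pi * Complex.I) * ∑' n : ℤ, n * β n * fourier n (x : UnitAddCircle)) x := by
  -- One power pays for the factor `n` of the derivative, the other two for absolute summability.
  obtain ⟨A, hA⟩ := h 3
  have hA2 : FourierBound β 2 A := hA.mono (by norm_num) le_rfl
  have hd : ∀ (n : ℤ) (y : ℝ), HasDerivAt (fun x : ℝ => β n * fourier n (x : UnitAddCircle))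
      ((2 * Real.pi * Complex.I) * (n * β n * fourier n (y : UnitAddCircle))) y := by
    intro n y
    refine ((hasDerivAt_fourier 1 n y).const_mul (β n)).congr_deriv ?_
    simp only [Complex.ofReal_one, div_one]
    ring
  rw [← tsum_mul_left]
  refine hasDerivAt_tsum (u := fun n : ℤ => ‖(2 * Real.pi * Complex.I : ℂ)‖ * ‖(n : ℂ) * β n‖)
    ((hA.intCast_mul.summable).mul_left _) hd (fun n y => ?_) (y₀ := 0) ?_ x
  · rw [norm_mul, norm_fourier_term]
  · refine Summable.of_norm ?_
    simp only [norm_fourier_term]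
    exact hA2.summable

/-- The derivative is a series of the same kind with coefficients `n β n`, so the induction on the
order runs over all rapidly decaying `β` at once. -/
theorem contDiff_tsum_fourier {β : ℤ → ℂ} (h : ∀ N, ∃ A, FourierBound β N A) :
    ContDiff ℝ ∞ fun x : ℝ => ∑' n : ℤ, β n * fourier n (x : UnitAddCircle) := by
  rw [contDiff_infty]
  intro m
  induction m generalizing β with
  | zero =>
    have hd : Differentiable ℝ fun x : ℝ => ∑' n : ℤ, β n * fourier n (x : UnitAddCircle) :=
      fun x => (hasDerivAt_tsum_fourier h x).differentiableAt
    exact contDiff_zero.2 hd.continuous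
  | succ m ih =>
    have h' : ∀ N, ∃ A, FourierBound (fun n : ℤ => n * β n) N A := fun N => by
      obtain ⟨A, hA⟩ := h (N + 1)
      exact ⟨A, hA.intCast_mul⟩
    rw [Nat.cast_add, Nat.cast_one, contDiff_succ_iff_deriv]
    refine ⟨fun x => (hasDerivAt_tsum_fourier h x).differentiableAt, by simp, ?_⟩
    rw [funext fun x => (hasDerivAt_tsum_fourier h x).deriv]
    exact contDiff_const.mul (ih h')

/-- The Fourier coefficient as a continuous linear functional. -/
def fourierCoeffL (n : ℤ) : C(UnitAddCircle, ℂ) →L[ℂ] ℂ :=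
  (innerSL ℂ (fourierBasis (T := (1 : ℝ)) n)).comp
    (ContinuousMap.toLp 2 AddCircle.haarAddCircle ℂ)

theorem fourierCoeffL_apply (n : ℤ) (f : C(UnitAddCircle, ℂ)) :
    fourierCoeffL n f = fourierCoeff f n := by
  change inner ℂ (fourierBasis (T := (1 : ℝ)) n)
    (ContinuousMap.toLp 2 AddCircle.haarAddCircle ℂ f) = _
  rw [← HilbertBasis.repr_apply_apply, fourierBasis_repr, fourierCoeff_toLp]

theorem fourierCoeff_add (f g : C(UnitAddCircle, ℂ)) (n : ℤ) :
    fourierCoeff (f + g : C(UnitAddCircle, ℂ)) n = fourierCoeff f n + fourierCoeff g n := by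
  simp only [← fourierCoeffL_apply, map_add]

theorem fourierCoeff_smul (r : ℂ) (f : C(UnitAddCircle, ℂ)) (n : ℤ) :
    fourierCoeff (r • f : C(UnitAddCircle, ℂ)) n = r * fourierCoeff f n := by
  simp only [← fourierCoeffL_apply, map_smul, smul_eq_mul]

theorem fourierCoeffL_fourier (m n : ℤ) :
    fourierCoeffL m (fourier n) = if n = m then 1 else 0 := by
  rw [fourierCoeffL_apply]
  have := fourierCoeff_fourier (T := (1 : ℝ)) n
  rw [this, Pi.single_apply]
  simp only [eq_comm]

theorem fourierCoeff_injective {f g : C(UnitAddCircle, ℂ)}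
    (h : ∀ n, fourierCoeff f n = fourierCoeff g n) : f = g := by
  refine ContinuousMap.toLp_injective (p := 2) (𝕜 := ℂ)
    (AddCircle.haarAddCircle (T := (1 : ℝ))) ?_
  refine (fourierBasis (T := (1 : ℝ))).repr.injective ?_
  ext n
  rw [fourierBasis_repr, fourierBasis_repr, fourierCoeff_toLp, fourierCoeff_toLp, h]

theorem norm_fourier_le (n : ℤ) : ‖(fourier n : C(UnitAddCircle, ℂ))‖ ≤ 1 := by
  rw [fourier_norm]

/-- An arbitrary injective indexing `i` covers the full series and the two half-series that define
`F_+` and `F_-`. -/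
theorem fourierCoeff_of_hasSum {ι : Type*} {i : ι → ℤ} (hi : Function.Injective i) {β : ι → ℂ}
    {f : C(UnitAddCircle, ℂ)} (h : HasSum (fun j => β j • fourier (i j)) f) :
    (∀ j, fourierCoeff f (i j) = β j) ∧ ∀ n, n ∉ Set.range i → fourierCoeff f n = 0 := by
  constructor
  · intro j
    have h1 := (fourierCoeffL (i j)).hasSum h
    rw [← fourierCoeffL_apply]
    classical
    refine h1.unique ((hasSum_ite_eq j (β j)).congr_fun fun k => ?_)
    simp only [map_smul, fourierCoeffL_fourier, smul_eq_mul, hi.eq_iff]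
    split_ifs with hk <;> simp [hk]
  · intro n hn
    have h1 := (fourierCoeffL n).hasSum h
    rw [← fourierCoeffL_apply]
    refine h1.unique (hasSum_zero.congr_fun fun k => ?_)
    have : i k ≠ n := fun h => hn ⟨k, h⟩
    simp [fourierCoeffL_fourier, this]

theorem summable_smul_fourier {ι : Type*} (i : ι → ℤ) {β : ι → ℂ}
    (h : Summable fun j => ‖β j‖) :
    Summable fun j => β j • (fourier (i j) : C(UnitAddCircle, ℂ)) := by
  refine Summable.of_norm_bounded h fun j => ?_
  rw [norm_smul]
  exact mul_le_of_le_one_right (norm_nonneg _) (norm_fourier_le _)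

/-- Converse of `fourierCoeff_rapid`: symbols can be prescribed through their coefficients. -/
theorem exists_smooth_fourierCoeff {β : ℤ → ℂ} (h : ∀ N, ∃ A, FourierBound β N A) :
    ∃ f : smoothCircle, ∀ n, fourierCoeff f.1 n = β n := by
  obtain ⟨A, hA⟩ := h 2
  have hs := (summable_smul_fourier id hA.summable).hasSum
  refine ⟨⟨_, ?_⟩, (fourierCoeff_of_hasSum Function.injective_id hs).1⟩
  change ContDiff ℝ ∞ (pullback _)
  convert contDiff_tsum_fourier h using 1
  funext x
  exact ((ContinuousMap.evalCLM ℂ (x : UnitAddCircle)).hasSum hs).tsum_eq.symm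

theorem norm_le_tsum_fourierCoeff {f : C(UnitAddCircle, ℂ)}
    (h : Summable fun n => ‖fourierCoeff f n‖) : ‖f‖ ≤ ∑' n, ‖fourierCoeff f n‖ := by
  have hs := hasSum_fourier_series_of_summable h.of_norm
  refine hs.norm_le_of_bounded h.hasSum fun n => ?_
  rw [norm_smul]
  exact mul_le_of_le_one_right (norm_nonneg _) (norm_fourier_le _)

theorem exists_fourierBound (f : smoothCircle) (N : ℕ) :
    ∃ A, FourierBound (fourierCoeff f.1) N A := by
  obtain ⟨A, -, hA⟩ := fourierCoeff_rapid f N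
  exact ⟨A, hA⟩

theorem FourierBound.of_norm_le {β γ : ℤ → ℂ} {N : ℕ} {A : ℝ} (h : FourierBound β N A)
    (hγ : ∀ n, ‖γ n‖ ≤ ‖β n‖) : FourierBound γ N A := fun n =>
  le_trans (mul_le_mul_of_nonneg_right (hγ n) (by positivity)) (h n)

theorem fourierCoeff_nonnegFreqPart (F : smoothCircle) (n : ℤ) :
    fourierCoeff (nonnegFreqPart F) n = if 0 ≤ n then fourierCoeff F.1 n else 0 := by
  obtain ⟨A, hA⟩ := exists_fourierBound F 2
  have hi : Function.Injective fun n : ℕ => (n : ℤ) := Nat.cast_injective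
  have hs := fourierCoeff_of_hasSum hi
    (summable_smul_fourier _ (hA.summable.comp_injective hi)).hasSum
  split_ifs with h
  · obtain ⟨m, rfl⟩ := Int.eq_ofNat_of_zero_le h
    exact hs.1 m
  · refine hs.2 n ?_
    rintro ⟨m, rfl⟩
    exact h (Int.natCast_nonneg m)

theorem fourierCoeff_negFreqPart (F : smoothCircle) (n : ℤ) :
    fourierCoeff (negFreqPart F) n = if n < 0 then fourierCoeff F.1 n else 0 := by
  obtain ⟨A, hA⟩ := exists_fourierBound F 2
  have hi : Function.Injective fun n : ℕ => -((n : ℤ) + 1) := fun a b h => by simpa using h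
  have hs := fourierCoeff_of_hasSum hi
    (summable_smul_fourier _ (hA.summable.comp_injective hi)).hasSum
  split_ifs with h
  · have h0 : n = -(((-n - 1).toNat : ℤ) + 1) := by omega
    rw [h0]
    exact hs.1 _
  · refine hs.2 n ?_
    rintro ⟨m, rfl⟩
    exact h (by simp only; omega)

theorem nonnegFreqPart_add_negFreqPart (F : smoothCircle) :
    nonnegFreqPart F + negFreqPart F = F.1 := by
  refine fourierCoeff_injective fun n => ?_
  rw [fourierCoeff_add, fourierCoeff_nonnegFreqPart, fourierCoeff_negFreqPart]
  rcases lt_or_ge n 0 with h | h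
  · simp [h, not_le.2 h]
  · simp [h, not_lt.2 h]

theorem negFreqPart_mem (F : smoothCircle) : negFreqPart F ∈ smoothCircle := by
  obtain ⟨g, hg⟩ := exists_smooth_fourierCoeff (β := fourierCoeff (negFreqPart F)) fun N => by
    obtain ⟨A, hA⟩ := exists_fourierBound F N
    refine ⟨A, hA.of_norm_le fun n => ?_⟩
    rw [fourierCoeff_negFreqPart]
    split_ifs <;> simp
  rw [← fourierCoeff_injective hg]
  exact g.2

/-- Parseval's identity for the vectors `M_f^* e_n` and `M_g e_0`. -/
theorem hasSum_fourierCoeff_mul (f g : C(UnitAddCircle, ℂ)) (n : ℤ) :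
    HasSum (fun j : ℤ => fourierCoeff f (n - j) * fourierCoeff g j)
      (fourierCoeff (f * g : C(UnitAddCircle, ℂ)) n) := by
  have := (fourierBasis (T := (1 : ℝ))).hasSum_inner_mul_inner
    (adjoint (mulOp f) (fourierBasis (T := (1 : ℝ)) n))
    (mulOp g (fourierBasis (T := (1 : ℝ)) 0))
  simp only [adjoint_inner_left, inner_mulOp_fourierBasis, sub_zero] at this
  have h : fourierBasis (T := (1 : ℝ)) (0 : ℤ) =
      ContinuousMap.toLp 2 AddCircle.haarAddCircle ℂ (fourier (0 : ℤ)) := by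
    rw [coe_fourierBasis]
  have h' : inner ℂ (fourierBasis (T := (1 : ℝ)) n)
      (mulOp f (mulOp g (fourierBasis (T := (1 : ℝ)) 0))) =
        fourierCoeff (f * g : C(UnitAddCircle, ℂ)) n := by
    rw [h, mulOp_toLp, inner_mulOp_toLp, ← mul_assoc, fourierCoeff_mul_fourier, sub_zero]
  rwa [h'] at this

/-- The inequality `1 + |n| ≤ (1 + |n - j|)(1 + |j|)` splits the weight between the factors of the
convolution; the two extra powers on `g` make the sum over `j` converge. -/
theorem FourierBound.mul {f g : C(UnitAddCircle, ℂ)} {N : ℕ} {A B : ℝ}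
    (hf : FourierBound (fourierCoeff f) N A) (hg : FourierBound (fourierCoeff g) (N + 2) B) :
    FourierBound (fourierCoeff (f * g : C(UnitAddCircle, ℂ))) N
      (A * B * ∑' n : ℤ, ((1 + |(n : ℝ)|) ^ 2)⁻¹) := fun n => by
  have hn : 0 < (1 + |(n : ℝ)|) ^ N := by positivity
  rw [← le_div_iff₀ hn, ← (hasSum_fourierCoeff_mul f g n).tsum_eq]
  refine tsum_of_norm_bounded
    ((summable_int_inv_sq.hasSum.mul_left (A * B)).div_const ((1 + |(n : ℝ)|) ^ N)) fun j => ?_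
  rw [le_div_iff₀ hn, ← div_eq_mul_inv, le_div_iff₀ (by positivity), norm_mul]
  have h1 := hf (n - j)
  have h2 := hg j
  push_cast at h1
  have h3 : 1 + |(n : ℝ)| ≤ (1 + |(n : ℝ) - j|) * (1 + |(j : ℝ)|) := by
    have := abs_add_le ((n : ℝ) - j) j
    rw [sub_add_cancel] at this
    nlinarith [mul_nonneg (abs_nonneg ((n : ℝ) - j)) (abs_nonneg (j : ℝ))]
  calc ‖fourierCoeff f (n - j)‖ * ‖fourierCoeff g j‖ * (1 + |(n : ℝ)|) ^ N * (1 + |(j : ℝ)|) ^ 2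
      ≤ ‖fourierCoeff f (n - j)‖ * ‖fourierCoeff g j‖ *
          ((1 + |(n : ℝ) - j|) * (1 + |(j : ℝ)|)) ^ N * (1 + |(j : ℝ)|) ^ 2 := by gcongr
    _ = (‖fourierCoeff f (n - j)‖ * (1 + |(n : ℝ) - j|) ^ N) *
          (‖fourierCoeff g j‖ * (1 + |(j : ℝ)|) ^ (N + 2)) := by
        rw [mul_pow]
        ring
    _ ≤ A * B := mul_le_mul h1 h2 (by positivity) hf.nonneg

/-! ### Quantitative bounds for matrices -/

/-- The matrix `c` satisfies `|c k l| (1 + k)^N (1 + l)^N ≤ A`. -/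
def MatrixBound (c : ℕ → ℕ → ℂ) (N : ℕ) (A : ℝ) : Prop :=
  ∀ k l : ℕ, ‖c k l‖ * ((1 + (k : ℝ)) ^ N * (1 + (l : ℝ)) ^ N) ≤ A

/-- The matrix `c` satisfies `|c k l| (1 + |k - l|)^N ≤ A`. -/
def BandBound (c : ℕ → ℕ → ℂ) (N : ℕ) (A : ℝ) : Prop :=
  ∀ k l : ℕ, ‖c k l‖ * (1 + |(k : ℝ) - l|) ^ N ≤ A

theorem MatrixBound.nonneg {c : ℕ → ℕ → ℂ} {N : ℕ} {A : ℝ} (h : MatrixBound c N A) : 0 ≤ A :=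
  le_trans (by positivity) (h 0 0)

theorem BandBound.nonneg {c : ℕ → ℕ → ℂ} {N : ℕ} {A : ℝ} (h : BandBound c N A) : 0 ≤ A :=
  le_trans (by positivity) (h 0 0)

theorem MatrixBound.mono {c : ℕ → ℕ → ℂ} {M N : ℕ} {A B : ℝ} (h : MatrixBound c N A)
    (hM : M ≤ N) (hA : A ≤ B) : MatrixBound c M B := fun k l => by
  refine le_trans ?_ ((h k l).trans hA)
  have hk : (0 : ℝ) ≤ k := k.cast_nonneg
  have hl : (0 : ℝ) ≤ l := l.cast_nonneg
  gcongr <;> linarith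

theorem MatrixBound.add {c d : ℕ → ℕ → ℂ} {N : ℕ} {A B : ℝ} (hc : MatrixBound c N A)
    (hd : MatrixBound d N B) : MatrixBound (fun k l => c k l + d k l) N (A + B) := fun k l => by
  calc ‖c k l + d k l‖ * ((1 + (k : ℝ)) ^ N * (1 + (l : ℝ)) ^ N)
      ≤ (‖c k l‖ + ‖d k l‖) * ((1 + (k : ℝ)) ^ N * (1 + (l : ℝ)) ^ N) := by
        gcongr
        exact norm_add_le _ _
    _ ≤ A + B := by
        rw [add_mul]
        exact add_le_add (hc k l) (hd k l)

theorem MatrixBound.swap {c : ℕ → ℕ → ℂ} {N : ℕ} {A : ℝ} (h : MatrixBound c N A) :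
    MatrixBound (fun k l => c l k) N A := fun k l => by
  rw [mul_comm ((1 + (k : ℝ)) ^ N)]
  exact h l k

theorem BandBound.swap {c : ℕ → ℕ → ℂ} {N : ℕ} {A : ℝ} (h : BandBound c N A) :
    BandBound (fun k l => c l k) N A := fun k l => by
  rw [abs_sub_comm]
  exact h l k

theorem MatrixBound.bandBound {c : ℕ → ℕ → ℂ} {N : ℕ} {A : ℝ} (h : MatrixBound c N A) :
    BandBound c N A := fun k l => by
  refine le_trans ?_ (h k l)
  rw [← mul_pow]
  have hk : (0 : ℝ) ≤ k := k.cast_nonneg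
  have hl : (0 : ℝ) ≤ l := l.cast_nonneg
  have h1 : |(k : ℝ) - l| ≤ k + l := abs_le.2 ⟨by linarith, by linarith⟩
  gcongr
  nlinarith [mul_nonneg hk hl]

theorem exists_matrixBound {E : HilbertBasis ℕ ℂ H} {c : H →L[ℂ] H} (hc : c ∈ smoothCompact E)
    (N : ℕ) : ∃ A, MatrixBound (coef E c) N A :=
  (rapidlyDecaying_iff _).1 ((isSmoothCompact_iff E c).1 hc) N

/-- The weight in `k` is transferred to `j` by `1 + k ≤ (1 + |k - j|)(1 + j)`, and two further
powers of `1 + j` sum the series. -/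
theorem BandBound.mul_matrixBound {α β : ℕ → ℕ → ℂ} {N : ℕ} {A B : ℝ} (hα : BandBound α N A)
    (hβ : MatrixBound β (N + 2) B) :
    MatrixBound (fun k l => ∑' j, α k j * β j l) N
      (A * B * ∑' n : ℕ, ((1 + (n : ℝ)) ^ 2)⁻¹) := fun k l => by
  have hkl : 0 < (1 + (k : ℝ)) ^ N * (1 + (l : ℝ)) ^ N := by positivity
  rw [← le_div_iff₀ hkl]
  have hs := (summable_inv_sq.hasSum.mul_left (A * B)).div_const
    ((1 + (k : ℝ)) ^ N * (1 + (l : ℝ)) ^ N)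
  refine tsum_of_norm_bounded hs fun j => ?_
  rw [le_div_iff₀ hkl, ← div_eq_mul_inv, le_div_iff₀ (by positivity), norm_mul]
  have h1 := hα k j
  have h2 := hβ j l
  have hA := hα.nonneg
  have hj : (0 : ℝ) ≤ j := j.cast_nonneg
  have hl : (0 : ℝ) ≤ l := l.cast_nonneg
  have h3 : 1 + (k : ℝ) ≤ (1 + |(k : ℝ) - j|) * (1 + j) := by
    have := le_abs_self ((k : ℝ) - j)
    nlinarith [mul_nonneg (abs_nonneg ((k : ℝ) - j)) hj]
  calc ‖α k j‖ * ‖β j l‖ * ((1 + (k : ℝ)) ^ N * (1 + (l : ℝ)) ^ N) * (1 + (j : ℝ)) ^ 2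
      ≤ ‖α k j‖ * ‖β j l‖ * (((1 + |(k : ℝ) - j|) * (1 + j)) ^ N * (1 + (l : ℝ)) ^ (N + 2))
          * (1 + (j : ℝ)) ^ 2 := by
        gcongr
        · linarith
        · omega
    _ = (‖α k j‖ * (1 + |(k : ℝ) - j|) ^ N) *
          (‖β j l‖ * ((1 + (j : ℝ)) ^ (N + 2) * (1 + (l : ℝ)) ^ (N + 2))) := by
        rw [mul_pow]
        ring
    _ ≤ A * B := by gcongr

theorem MatrixBound.coef_mul_left {E : HilbertBasis ℕ ℂ H} {a b : H →L[ℂ] H} {N : ℕ} {A B : ℝ}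
    (ha : BandBound (coef E a) N A) (hb : MatrixBound (coef E b) (N + 2) B) :
    MatrixBound (coef E (a * b)) N (A * B * ∑' n : ℕ, ((1 + (n : ℝ)) ^ 2)⁻¹) := by
  convert ha.mul_matrixBound hb using 3
  exact (hasSum_coef_mul E a b _ _).tsum_eq.symm

theorem MatrixBound.coef_mul_right {E : HilbertBasis ℕ ℂ H} {a b : H →L[ℂ] H} {N : ℕ} {A B : ℝ}
    (ha : MatrixBound (coef E a) (N + 2) A) (hb : BandBound (coef E b) N B) :
    MatrixBound (coef E (a * b)) N (B * A * ∑' n : ℕ, ((1 + (n : ℝ)) ^ 2)⁻¹) := by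
  convert (hb.swap.mul_matrixBound ha.swap).swap using 3
  rw [← (hasSum_coef_mul E a b _ _).tsum_eq]
  simp only [mul_comm]

theorem FourierBound.bandBound_toeplitz (E : HilbertBasis ℕ ℂ H) {f : C(UnitAddCircle, ℂ)}
    {N : ℕ} {A : ℝ} (hf : FourierBound (fourierCoeff f) N A) :
    BandBound (coef E (toeplitz E f)) N A := fun k l => by
  have := hf ((k : ℤ) - l)
  rw [coef_toeplitz]
  simpa using this

/-- The defect is the part of the convolution over intermediate frequencies `-(j + 1) < 0`. There
the frequency of `f` is at least `k` and that of `g` is at least `l` and `j` in absolute value. Thus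
`f` supplies the decay in `k`, and `g` the decay in `l` together with the summability in `j`. -/
theorem matrixBound_toeplitz_mul_sub (E : HilbertBasis ℕ ℂ H) {f g : C(UnitAddCircle, ℂ)}
    {N : ℕ} {A B : ℝ} (hf : FourierBound (fourierCoeff f) N A)
    (hg : FourierBound (fourierCoeff g) (N + 2) B) :
    MatrixBound (coef E (toeplitz E f * toeplitz E g - toeplitz E (f * g))) N
      (A * B * ∑' n : ℕ, ((1 + (n : ℝ)) ^ 2)⁻¹) := fun k l => by
  have hkl : 0 < (1 + (k : ℝ)) ^ N * (1 + (l : ℝ)) ^ N := by positivity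
  rw [← le_div_iff₀ hkl, coef_toeplitz_mul_sub, norm_neg]
  have hs := (summable_inv_sq.hasSum.mul_left (A * B)).div_const
    ((1 + (k : ℝ)) ^ N * (1 + (l : ℝ)) ^ N)
  refine tsum_of_norm_bounded hs fun j => ?_
  rw [le_div_iff₀ hkl, ← div_eq_mul_inv, le_div_iff₀ (by positivity), norm_mul]
  have h1 := hf ((k : ℤ) + (j + 1))
  have h2 := hg (-((j : ℤ) + 1) - l)
  push_cast at h1 h2
  have hj : (0 : ℝ) ≤ j := j.cast_nonneg
  have hl : (0 : ℝ) ≤ l := l.cast_nonneg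
  have hk : (0 : ℝ) ≤ k := k.cast_nonneg
  rw [abs_of_nonneg (by linarith)] at h1
  rw [abs_of_nonpos (by linarith)] at h2
  have e1 : 1 + (k : ℝ) ≤ 1 + ((k : ℝ) + (j + 1)) := by linarith
  have e2 : 1 + (l : ℝ) ≤ 1 + -(-((j : ℝ) + 1) - l) := by linarith
  have e3 : 1 + (j : ℝ) ≤ 1 + -(-((j : ℝ) + 1) - l) := by linarith
  have e4 : (1 + (l : ℝ)) ^ N * (1 + (j : ℝ)) ^ 2 ≤ (1 + -(-((j : ℝ) + 1) - l)) ^ (N + 2) := by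
    rw [pow_add]
    have : (0 : ℝ) ≤ 1 + -(-((j : ℝ) + 1) - l) := by linarith
    gcongr
  calc ‖fourierCoeff f ((k : ℤ) + (j + 1))‖ * ‖fourierCoeff g (-((j : ℤ) + 1) - l)‖ *
        ((1 + (k : ℝ)) ^ N * (1 + (l : ℝ)) ^ N) * (1 + (j : ℝ)) ^ 2
      = (‖fourierCoeff f ((k : ℤ) + (j + 1))‖ * (1 + (k : ℝ)) ^ N) *
        (‖fourierCoeff g (-((j : ℤ) + 1) - l)‖ * ((1 + (l : ℝ)) ^ N * (1 + (j : ℝ)) ^ 2)) := by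
        ring
    _ ≤ A * B := by
        refine mul_le_mul (le_trans ?_ h1) (le_trans ?_ h2) (by positivity) hf.nonneg <;> gcongr

theorem summable_inv_sq_mul_inv_sq :
    Summable fun p : ℕ × ℕ => ((1 + (p.1 : ℝ)) ^ 2)⁻¹ * ((1 + (p.2 : ℝ)) ^ 2)⁻¹ :=
  summable_inv_sq.mul_of_nonneg summable_inv_sq (fun n => by positivity) (fun n => by positivity)

/-- A matrix with decaying entries is the matrix of a bounded operator. -/
theorem MatrixBound.exists_coef_eq (E : HilbertBasis ℕ ℂ H) {c : ℕ → ℕ → ℂ} {A : ℝ}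
    (h : MatrixBound c 2 A) : ∃ a : H →L[ℂ] H, (∀ k l, coef E a k l = c k l) ∧
      ‖a‖ ≤ A * ∑' p : ℕ × ℕ, ((1 + (p.1 : ℝ)) ^ 2)⁻¹ * ((1 + (p.2 : ℝ)) ^ 2)⁻¹ := by
  have hb : ∀ p : ℕ × ℕ, ‖c p.1 p.2 • InnerProductSpace.rankOne ℂ (E p.1) (E p.2)‖ ≤
      A * (((1 + (p.1 : ℝ)) ^ 2)⁻¹ * ((1 + (p.2 : ℝ)) ^ 2)⁻¹) := fun p => by
    rw [norm_smul, InnerProductSpace.norm_rankOne, E.orthonormal.1, E.orthonormal.1, mul_one,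
      mul_one, ← mul_inv, ← div_eq_mul_inv, le_div_iff₀ (by positivity)]
    exact h p.1 p.2
  have hs : Summable fun p : ℕ × ℕ =>
      c p.1 p.2 • InnerProductSpace.rankOne ℂ (E p.1) (E p.2) :=
    Summable.of_norm_bounded (summable_inv_sq_mul_inv_sq.mul_left A) hb
  exact ⟨_, coef_of_hasSum E hs.hasSum,
    tsum_of_norm_bounded (summable_inv_sq_mul_inv_sq.hasSum.mul_left A) hb⟩

theorem exists_smoothCompact_coef (E : HilbertBasis ℕ ℂ H) {c : ℕ → ℕ → ℂ}
    (h : ∀ N, ∃ A, MatrixBound c N A) :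
    ∃ a ∈ smoothCompact E, ∀ k l, coef E a k l = c k l := by
  obtain ⟨A, hA⟩ := h 2
  obtain ⟨a, ha, -⟩ := hA.exists_coef_eq E
  refine ⟨a, (isSmoothCompact_iff E a).2 ((rapidlyDecaying_iff _).2 ?_), ha⟩
  rwa [funext₂ ha]

/-! ### The symbol -/

theorem coef_smul (E : HilbertBasis ℕ ℂ H) (r : ℂ) (a : H →L[ℂ] H) (k l : ℕ) :
    coef E (r • a) k l = r * coef E a k l := by
  simp [coef]

/-- The symbol is determined by the limits of the matrix along its diagonals. -/
theorem toeplitz_add_injective (E : HilbertBasis ℕ ℂ H) {f g : C(UnitAddCircle, ℂ)}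
    {c d : H →L[ℂ] H} (hc : c ∈ smoothCompact E) (hd : d ∈ smoothCompact E)
    (h : toeplitz E f + c = toeplitz E g + d) : f = g ∧ c = d := by
  have hfg : f = g := by
    refine fourierCoeff_injective fun n => ?_
    obtain ⟨A, hA⟩ := exists_matrixBound ((smoothCompact E).sub_mem hd hc) 1
    have key : ∀ m : ℕ, ‖fourierCoeff f n - fourierCoeff g n‖ ≤ A * (1 / ((m : ℝ) + 1)) := by
      intro m
      -- The position `(m + n⁺, m + n⁻)` runs down the `n`-th diagonal. There the Toeplitz parts
      -- differ by a constant, which is also an entry of `d - c` and so is `O(1/m)`.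
      have h1 := congrArg (fun a => coef E a (m + n.toNat) (m + (-n).toNat)) h
      simp only [coef_add, coef_toeplitz] at h1
      have h2 : ((m + n.toNat : ℕ) : ℤ) - (m + (-n).toNat : ℕ) = n := by omega
      rw [h2] at h1
      have h3 := hA (m + n.toNat) (m + (-n).toNat)
      have h4 : coef E d (m + n.toNat) (m + (-n).toNat) - coef E c (m + n.toNat) (m + (-n).toNat) =
          fourierCoeff f n - fourierCoeff g n := by linear_combination -h1
      rw [coef_sub, h4] at h3
      rw [mul_one_div, le_div_iff₀ (by positivity)]
      refine le_trans ?_ h3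
      gcongr
      push_cast
      have e1 : (0 : ℝ) ≤ n.toNat := Nat.cast_nonneg _
      have e2 : (0 : ℝ) ≤ (-n).toNat := Nat.cast_nonneg _
      have e3 : (0 : ℝ) ≤ m := Nat.cast_nonneg _
      nlinarith [mul_nonneg e1 e2, mul_nonneg e1 e3, mul_nonneg e2 e3]
    have hlim := tendsto_one_div_add_atTop_nhds_zero_nat (𝕜 := ℝ).const_mul A
    rw [mul_zero] at hlim
    have := ge_of_tendsto' hlim key
    exact sub_eq_zero.1 (norm_le_zero_iff.1 this)
  subst hfg
  exact ⟨rfl, add_left_cancel h⟩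

/-- `a = T(f) + c` where the Fourier coefficients of `f` and the matrix of `c` are bounded by `A`
for the weights of order `N`. -/
def SymbolBound (E : HilbertBasis ℕ ℂ H) (a : H →L[ℂ] H) (N : ℕ) (A : ℝ) : Prop :=
  ∃ f : smoothCircle, ∃ c ∈ smoothCompact E, a = toeplitz E f.1 + c ∧
    FourierBound (fourierCoeff f.1) N A ∧ MatrixBound (coef E c) N A

theorem exists_symbolBound {E : HilbertBasis ℕ ℂ H} (a : smoothToeplitz E) (N : ℕ) :
    ∃ A, SymbolBound E a N A := by
  obtain ⟨_, f, hf, c, hc, rfl⟩ := a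
  obtain ⟨A, hA⟩ := exists_fourierBound ⟨f, hf⟩ N
  obtain ⟨B, hB⟩ := exists_matrixBound hc N
  exact ⟨max A B, ⟨f, hf⟩, c, hc, rfl, hA.mono le_rfl (le_max_left _ _),
    hB.mono le_rfl (le_max_right _ _)⟩

theorem SymbolBound.mono {E : HilbertBasis ℕ ℂ H} {a : H →L[ℂ] H} {M N : ℕ} {A B : ℝ}
    (h : SymbolBound E a N A) (hM : M ≤ N) (hA : A ≤ B) : SymbolBound E a M B := by
  obtain ⟨f, c, hc, rfl, hf, hb⟩ := h
  exact ⟨f, c, hc, rfl, hf.mono hM hA, hb.mono hM hA⟩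

theorem SymbolBound.bandBound {E : HilbertBasis ℕ ℂ H} {a : H →L[ℂ] H} {N : ℕ} {A : ℝ}
    (h : SymbolBound E a N A) : BandBound (coef E a) N (A + A) := by
  obtain ⟨f, c, hc, rfl, hf, hb⟩ := h
  intro k l
  rw [coef_add]
  refine le_trans (mul_le_mul_of_nonneg_right (norm_add_le _ _) (by positivity)) ?_
  rw [add_mul]
  exact add_le_add (hf.bandBound_toeplitz E k l) (hb.bandBound k l)

theorem SymbolBound.add {E : HilbertBasis ℕ ℂ H} {a b : H →L[ℂ] H} {N : ℕ} {A B : ℝ}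
    (ha : SymbolBound E a N A) (hb : SymbolBound E b N B) : SymbolBound E (a + b) N (A + B) := by
  obtain ⟨f, c, hc, rfl, hf, hc'⟩ := ha
  obtain ⟨g, d, hd, rfl, hg, hd'⟩ := hb
  refine ⟨f + g, c + d, add_mem hc hd, ?_, ?_, ?_⟩
  · rw [Subalgebra.coe_add, toeplitz_add]
    abel
  · intro n
    rw [Subalgebra.coe_add, fourierCoeff_add]
    exact hf.add hg n
  · intro k l
    rw [coef_add]
    exact hc'.add hd' k l

theorem toeplitz_smul (E : HilbertBasis ℕ ℂ H) (r : ℂ) (f : C(UnitAddCircle, ℂ)) :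
    toeplitz E (r • f) = r • toeplitz E f := by
  refine coef_ext E fun k l => ?_
  rw [coef_smul, coef_toeplitz, coef_toeplitz, fourierCoeff_smul]

theorem toeplitz_zero (E : HilbertBasis ℕ ℂ H) : toeplitz E 0 = 0 := by
  have := toeplitz_algebraMap E 0
  rwa [map_zero, map_zero] at this

theorem symbolBound_zero (E : HilbertBasis ℕ ℂ H) (N : ℕ) : SymbolBound E 0 N 0 := by
  refine ⟨0, 0, zero_mem _, ?_, fun n => ?_, fun k l => ?_⟩
  · rw [Subalgebra.coe_zero, toeplitz_zero, add_zero]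
  · rw [Subalgebra.coe_zero, ← fourierCoeffL_apply]
    simp
  · simp [coef]

theorem SymbolBound.neg {E : HilbertBasis ℕ ℂ H} {a : H →L[ℂ] H} {N : ℕ} {A : ℝ}
    (ha : SymbolBound E a N A) : SymbolBound E (-a) N A := by
  obtain ⟨f, c, hc, rfl, hf, hc'⟩ := ha
  refine ⟨(-1 : ℂ) • f, (-1 : ℂ) • c, Submodule.smul_mem _ _ hc, ?_, ?_, ?_⟩
  · rw [Subalgebra.coe_smul, toeplitz_smul]
    module
  · refine hf.of_norm_le fun n => ?_
    rw [Subalgebra.coe_smul, fourierCoeff_smul]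
    simp
  · intro k l
    rw [coef_smul, norm_mul]
    simpa using hc' k l

/-- The joint estimate for products in the smooth Toeplitz algebra. -/
theorem SymbolBound.mul (N : ℕ) : ∃ C : ℝ, ∀ (E : HilbertBasis ℕ ℂ H) (a b : H →L[ℂ] H) (A B : ℝ),
    SymbolBound E a (N + 2) A → SymbolBound E b (N + 2) B →
      SymbolBound E (a * b) N (C * A * B) := by
  set Z := ∑' n : ℤ, ((1 + |(n : ℝ)|) ^ 2)⁻¹ with hZ
  set Y := ∑' n : ℕ, ((1 + (n : ℝ)) ^ 2)⁻¹ with hY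
  have hZ0 : 0 ≤ Z := tsum_nonneg fun n => by positivity
  have hY0 : 0 ≤ Y := tsum_nonneg fun n => by positivity
  -- `Z` bounds the convolution of the symbols; the four `Y` come from the Toeplitz defect, `T(f)d`,
  -- `cT(g)` and `cd`.
  refine ⟨Z + 4 * Y, fun E a b A B ha hb => ?_⟩
  obtain ⟨f, c, hc, rfl, hf, hc'⟩ := ha
  obtain ⟨g, d, hd, rfl, hg, hd'⟩ := hb
  have hAB := mul_nonneg hf.nonneg hg.nonneg
  have hle : N ≤ N + 2 := by omega
  have hfN := hf.mono hle le_rfl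
  have hgN := hg.mono hle le_rfl
  have h1 := matrixBound_toeplitz_mul_sub E hfN hg
  have h2 := MatrixBound.coef_mul_left (hfN.bandBound_toeplitz E) hd'
  have h3 := MatrixBound.coef_mul_right hc' (hgN.bandBound_toeplitz E)
  have h4 := MatrixBound.coef_mul_left (hc'.mono hle le_rfl).bandBound hd'
  refine ⟨f * g, (toeplitz E f.1 * toeplitz E g.1 - toeplitz E (f.1 * g.1)) +
      (toeplitz E f.1 * d + c * toeplitz E g.1 + c * d), ?_, ?_, ?_, ?_⟩
  · exact (isSmoothCompact_toeplitz_mul_sub E f g).add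
      (((IsSmoothCompact.left_mul (banded_toeplitz E f) hd).add
        (IsSmoothCompact.right_mul hc (banded_toeplitz E g))).add
        (IsSmoothCompact.left_mul ((isSmoothCompact_iff E c).1 hc).banded hd))
  · rw [Subalgebra.coe_mul]
    noncomm_ring
  · refine (hfN.mul hg).mono le_rfl ?_
    rw [← hZ]
    nlinarith [mul_nonneg hAB hY0]
  · refine MatrixBound.mono (fun k l => ?_) le_rfl (?_ : A * B * Y + (A * B * Y + B * A * Y + A * B * Y) ≤ _)
    · rw [coef_add, coef_add, coef_add]
      exact h1.add ((h2.add h3).add h4) k l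
    · nlinarith [mul_nonneg hAB hZ0]

theorem HasSymbol.unique {E : HilbertBasis ℕ ℂ H} {a : smoothToeplitz E} {f g : smoothCircle}
    (hf : HasSymbol E a f) (hg : HasSymbol E a g) : f = g := by
  obtain ⟨c, hc, h⟩ := hf
  obtain ⟨d, hd, h'⟩ := hg
  exact Subtype.ext (toeplitz_add_injective E hc hd (h.symm.trans h')).1

theorem exists_hasSymbol {E : HilbertBasis ℕ ℂ H} (a : smoothToeplitz E) :
    ∃ f, HasSymbol E a f := by
  obtain ⟨_, f, hf, c, hc, rfl⟩ := a
  exact ⟨⟨f, hf⟩, c, hc, rfl⟩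

theorem hasSymbol_zero_iff {E : HilbertBasis ℕ ℂ H} {a : smoothToeplitz E} :
    HasSymbol E a 0 ↔ (a : H →L[ℂ] H) ∈ smoothCompact E := by
  have h0 := toeplitz_zero E
  rw [← Subalgebra.coe_zero smoothCircle] at h0
  constructor
  · rintro ⟨c, hc, h⟩
    rwa [h, h0, zero_add]
  · intro h
    exact ⟨a, h, by rw [h0, zero_add]⟩

theorem HasSymbol.add {E : HilbertBasis ℕ ℂ H} {a b : smoothToeplitz E} {f g : smoothCircle}
    (ha : HasSymbol E a f) (hb : HasSymbol E b g) : HasSymbol E (a + b) (f + g) := by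
  obtain ⟨c, hc, h⟩ := ha
  obtain ⟨d, hd, h'⟩ := hb
  refine ⟨c + d, add_mem hc hd, ?_⟩
  rw [Subalgebra.coe_add, Subalgebra.coe_add, toeplitz_add, h, h']
  abel

theorem HasSymbol.sub_mem {E : HilbertBasis ℕ ℂ H} {a b : smoothToeplitz E} {f : smoothCircle}
    (ha : HasSymbol E a f) (hb : HasSymbol E b f) :
    ((a - b : smoothToeplitz E) : H →L[ℂ] H) ∈ smoothCompact E := by
  obtain ⟨c, hc, h⟩ := ha
  obtain ⟨d, hd, h'⟩ := hb
  rw [Subalgebra.coe_sub, h, h', add_sub_add_left_eq_sub]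
  exact (smoothCompact E).sub_mem hc hd

theorem HasSymbol.mul {E : HilbertBasis ℕ ℂ H} {a b : smoothToeplitz E} {f g : smoothCircle}
    (ha : HasSymbol E a f) (hb : HasSymbol E b g) : HasSymbol E (a * b) (f * g) := by
  obtain ⟨c, hc, h⟩ := ha
  obtain ⟨d, hd, h'⟩ := hb
  refine ⟨(toeplitz E f.1 * toeplitz E g.1 - toeplitz E (f.1 * g.1)) +
      (toeplitz E f.1 * d + c * toeplitz E g.1 + c * d), ?_, ?_⟩
  · exact (isSmoothCompact_toeplitz_mul_sub E f g).add
      (((IsSmoothCompact.left_mul (banded_toeplitz E f) hd).add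
        (IsSmoothCompact.right_mul hc (banded_toeplitz E g))).add
        (IsSmoothCompact.left_mul ((isSmoothCompact_iff E c).1 hc).banded hd))
  · rw [Subalgebra.coe_mul, Subalgebra.coe_mul, h, h']
    noncomm_ring

/-- Symbols multiply commutatively, so `ab` and `ba` have the same symbol. -/
theorem commutator_mem_smoothCompact {E : HilbertBasis ℕ ℂ H} (a b : smoothToeplitz E) :
    ((a * b - b * a : smoothToeplitz E) : H →L[ℂ] H) ∈ smoothCompact E := by
  obtain ⟨f, hf⟩ := exists_hasSymbol a
  obtain ⟨g, hg⟩ := exists_hasSymbol b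
  have := hg.mul hf
  rw [mul_comm g f] at this
  exact (hf.mul hg).sub_mem this

/-! ### Continuity of linear maps of the smooth Toeplitz algebra -/

/-- Each weighted bound of `φ a` is controlled by a weighted bound of `a`. -/
def IsTame (E : HilbertBasis ℕ ℂ H) (φ : smoothToeplitz E →ₗ[ℂ] smoothToeplitz E) : Prop :=
  ∀ N, ∃ (M : ℕ) (C : ℝ), ∀ (a : smoothToeplitz E) (A : ℝ), SymbolBound E a M A →
    SymbolBound E (φ a) N (C * A)

/-- A matrix determines its bounded operator, so the infimum runs over one operator. -/
theorem matrixNorm_eq (E : HilbertBasis ℕ ℂ H) {m : ℕ → ℕ → ℂ} {b : H →L[ℂ] H}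
    (h : ∀ k l, coef E b k l = m k l) : matrixNorm E m = ‖b‖ₑ := by
  refine le_antisymm (iInf₂_le b h) (le_iInf₂ fun b' hb' => ?_)
  rw [coef_ext E fun k l => (h k l).trans (hb' k l).symm]

theorem matrixNorm_add_le (E : HilbertBasis ℕ ℂ H) (m m' : ℕ → ℕ → ℂ) :
    (matrixNorm E fun k l => m k l + m' k l) ≤ matrixNorm E m + matrixNorm E m' := by
  refine ENNReal.le_iInf₂_add_iInf₂ fun b hb b' hb' => ?_
  refine (iInf₂_le (b + b') fun k l => ?_).trans (enorm_add_le b b')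
  rw [coef_add, hb, hb']

theorem enorm_le_matrixNorm (E : HilbertBasis ℕ ℂ H) (m : ℕ → ℕ → ℂ) (k l : ℕ) :
    ‖m k l‖ₑ ≤ matrixNorm E m := by
  refine le_iInf₂ fun b hb => ?_
  rw [← hb k l, enorm_le_iff_norm_le, coef]
  refine (norm_inner_le_norm _ _).trans ?_
  rw [E.orthonormal.1, one_mul]
  refine (b.le_opNorm _).trans ?_
  rw [E.orthonormal.1, mul_one]

theorem compactNorm_add_le (E : HilbertBasis ℕ ℂ H) (M N : ℕ) (a b : H →L[ℂ] H) :
    compactNorm E M N (a + b) ≤ compactNorm E M N a + compactNorm E M N b := by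
  rw [compactNorm, compactNorm, compactNorm, ← Finset.sum_add_distrib]
  refine Finset.sum_le_sum fun j _ => ?_
  rw [← mul_add]
  gcongr
  refine le_trans (le_of_eq ?_) (matrixNorm_add_le E _ _)
  congr
  funext k l
  rw [coef_add, mul_add]

theorem circleNorm_nonneg (l : ℕ) (f : smoothCircle) : 0 ≤ circleNorm l f :=
  Finset.sum_nonneg fun _ _ => by positivity

theorem circleNorm_add_le (l : ℕ) (f g : smoothCircle) :
    circleNorm l (f + g) ≤ circleNorm l f + circleNorm l g := by
  rw [circleNorm, circleNorm, circleNorm, ← Finset.sum_add_distrib]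
  refine Finset.sum_le_sum fun j _ => ?_
  rw [← mul_add, map_add]
  gcongr
  exact norm_add_le _ _

theorem norm_circleDeriv_pow_le {l j : ℕ} (h : j ≤ l) (f : smoothCircle) :
    ‖((circleDeriv ^ j) f).1‖ ≤ circleNorm l f := by
  refine le_trans ?_ (Finset.single_le_sum
    (f := fun j => (l.choose j : ℝ) * ‖((circleDeriv ^ j) f).1‖)
    (fun _ _ => by positivity) (Finset.mem_range.2 (Nat.lt_succ_of_le h)))
  refine le_mul_of_one_le_left (norm_nonneg _) ?_
  exact_mod_cast Nat.choose_pos h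

theorem fourierCoeff_circleDeriv_pow (f : smoothCircle) (j : ℕ) (n : ℤ) :
    fourierCoeff ((circleDeriv ^ j) f).1 n = (n : ℂ) ^ j * fourierCoeff f.1 n := by
  induction j with
  | zero => simp
  | succ j ih =>
    rw [pow_succ', Module.End.mul_apply, fourierCoeff_circleDeriv, ih]
    ring

/-- The coefficient of the `N`-th derivative is `n^N f_n`, bounded by a sup norm; this combines with
`(1 + |n|)^N ≤ 2^N (1 + |n|^N)`. -/
theorem fourierBound_of_circleNorm {f : smoothCircle} {N l : ℕ} (h : N ≤ l) :
    FourierBound (fourierCoeff f.1) N (2 ^ N * (2 * circleNorm l f)) := fun n => by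
  have h1 := (norm_fourierCoeff_le f.1 n).trans (norm_circleDeriv_pow_le (Nat.zero_le l) f)
  have h2 := (norm_fourierCoeff_le ((circleDeriv ^ N) f).1 n).trans (norm_circleDeriv_pow_le h f)
  rw [fourierCoeff_circleDeriv_pow, norm_mul, norm_pow, Complex.norm_intCast] at h2
  have h3 : (1 + |(n : ℝ)|) ^ N ≤ 2 ^ N * (1 + |(n : ℝ)| ^ N) := by
    rcases le_total 1 |(n : ℝ)| with h | h
    · calc (1 + |(n : ℝ)|) ^ N ≤ (2 * |(n : ℝ)|) ^ N := by gcongr; linarith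
        _ = 2 ^ N * |(n : ℝ)| ^ N := mul_pow _ _ _
        _ ≤ _ := by gcongr; linarith
    · calc (1 + |(n : ℝ)|) ^ N ≤ 2 ^ N := by gcongr; linarith
        _ ≤ _ := le_mul_of_one_le_right (by positivity)
          (by linarith [pow_nonneg (abs_nonneg (n : ℝ)) N])
  calc ‖fourierCoeff f.1 n‖ * (1 + |(n : ℝ)|) ^ N
      ≤ ‖fourierCoeff f.1 n‖ * (2 ^ N * (1 + |(n : ℝ)| ^ N)) := by gcongr
    _ = 2 ^ N * (‖fourierCoeff f.1 n‖ + |(n : ℝ)| ^ N * ‖fourierCoeff f.1 n‖) := by ring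
    _ ≤ _ := by
        gcongr
        linarith

/-- The sup norm of each derivative is at most the `ℓ¹` norm of its coefficients, for which two
extra powers of the weight suffice. -/
theorem FourierBound.circleNorm_le {f : smoothCircle} {l : ℕ} {A : ℝ}
    (h : FourierBound (fourierCoeff f.1) (l + 2) A) :
    circleNorm l f ≤ (∑ j ∈ Finset.range (l + 1), (l.choose j : ℝ)) *
      ((∑' n : ℤ, ((1 + |(n : ℝ)|) ^ 2)⁻¹) * A) := by
  rw [circleNorm, Finset.sum_mul]
  refine Finset.sum_le_sum fun j hj => ?_
  gcongr
  have hb : FourierBound (fourierCoeff ((circleDeriv ^ j) f).1) 2 A := fun n => by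
    refine le_trans ?_ (h n)
    rw [fourierCoeff_circleDeriv_pow, norm_mul, norm_pow, Complex.norm_intCast, pow_add]
    have h1 : |(n : ℝ)| ^ j ≤ (1 + |(n : ℝ)|) ^ l :=
      (pow_le_pow_left₀ (abs_nonneg _) (by linarith) j).trans
        (pow_le_pow_right₀ (by linarith [abs_nonneg (n : ℝ)])
          (Nat.lt_succ_iff.1 (Finset.mem_range.1 hj)))
    calc |(n : ℝ)| ^ j * ‖fourierCoeff f.1 n‖ * (1 + |(n : ℝ)|) ^ 2
        ≤ (1 + |(n : ℝ)|) ^ l * ‖fourierCoeff f.1 n‖ * (1 + |(n : ℝ)|) ^ 2 := by gcongr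
      _ = _ := by ring
  refine (norm_le_tsum_fourierCoeff hb.summable).trans ?_
  rw [mul_comm, ← tsum_mul_left]
  exact hb.summable.tsum_le_tsum hb.norm_le (summable_int_inv_sq.mul_left A)

/-- Since `|k - l|` and `1 + l` are at most `(1 + k)(1 + l)`, the factors in the norm cost `M + N`
powers; the remaining two give a bounded operator by `MatrixBound.exists_coef_eq`. -/
theorem MatrixBound.compactNorm_le {E : HilbertBasis ℕ ℂ H} {c : H →L[ℂ] H} {M N : ℕ} {A : ℝ}
    (h : MatrixBound (coef E c) (M + N + 2) A) :
    compactNorm E M N c ≤ ENNReal.ofReal ((∑ j ∈ Finset.range (M + 1), (M.choose j : ℝ)) *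
      (A * ∑' p : ℕ × ℕ, ((1 + (p.1 : ℝ)) ^ 2)⁻¹ * ((1 + (p.2 : ℝ)) ^ 2)⁻¹)) := by
  rw [compactNorm, Finset.sum_mul, ENNReal.ofReal_sum_of_nonneg]
  swap
  · intro j _
    have := h.nonneg
    have : 0 ≤ ∑' p : ℕ × ℕ, ((1 + (p.1 : ℝ)) ^ 2)⁻¹ * ((1 + (p.2 : ℝ)) ^ 2)⁻¹ :=
      tsum_nonneg fun p => by positivity
    positivity
  refine Finset.sum_le_sum fun j hj => ?_
  have hj' := Nat.lt_succ_iff.1 (Finset.mem_range.1 hj)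
  have hb : MatrixBound (fun k l => ((k : ℂ) - l) ^ j * (1 + (l : ℂ)) ^ N * coef E c k l) 2 A := by
    intro k l
    refine le_trans ?_ (h k l)
    have hk : (0 : ℝ) ≤ k := k.cast_nonneg
    have hl : (0 : ℝ) ≤ l := l.cast_nonneg
    have e1 : ‖(k : ℂ) - l‖ ≤ (1 + (k : ℝ)) * (1 + l) := by
      have : ‖(k : ℂ) - l‖ ≤ k + l := by
        refine (norm_sub_le _ _).trans ?_
        simp
      nlinarith [mul_nonneg hk hl]
    have e2 : ‖(1 : ℂ) + l‖ = 1 + (l : ℝ) := by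
      have : (1 : ℂ) + l = ((1 + l : ℝ) : ℂ) := by push_cast; rfl
      rw [this, Complex.norm_real, Real.norm_of_nonneg (by positivity)]
    have e3 : (1 : ℝ) ≤ (1 + (k : ℝ)) * (1 + l) := by nlinarith [mul_nonneg hk hl]
    have e4 : (1 + (l : ℝ)) ≤ (1 + (k : ℝ)) * (1 + l) := by nlinarith [mul_nonneg hk hl]
    rw [norm_mul, norm_mul, norm_pow, norm_pow, e2, ← mul_pow, ← mul_pow]
    calc ‖(k : ℂ) - l‖ ^ j * (1 + (l : ℝ)) ^ N * ‖coef E c k l‖ * ((1 + (k : ℝ)) * (1 + l)) ^ 2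
        ≤ ((1 + (k : ℝ)) * (1 + l)) ^ M * ((1 + (k : ℝ)) * (1 + l)) ^ N * ‖coef E c k l‖ *
          ((1 + (k : ℝ)) * (1 + l)) ^ 2 := by
          gcongr
          exact (pow_le_pow_left₀ (norm_nonneg _) e1 j).trans (pow_le_pow_right₀ e3 hj')
      _ = _ := by ring
  obtain ⟨b, hb1, hb2⟩ := hb.exists_coef_eq E
  rw [matrixNorm_eq E hb1, ENNReal.ofReal_mul (by positivity), ENNReal.ofReal_natCast,
    ← ofReal_norm]
  gcongr

/-- The binomial theorem turns the sum over `j` into `(1 + |k - l|)^N (1 + l)^(2N)`. One of the two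
factors `(1 + l)^N` is spent on `1 + k ≤ (1 + |k - l|)(1 + l)`, which is why the second index is `2
* N`. -/
theorem matrixBound_of_compactNorm_le {E : HilbertBasis ℕ ℂ H} {c : H →L[ℂ] H} {N : ℕ} {t : ℝ}
    (ht : 0 ≤ t) (h : compactNorm E N (2 * N) c ≤ ENNReal.ofReal t) :
    MatrixBound (coef E c) N t := fun k l => by
  have hk : (0 : ℝ) ≤ k := k.cast_nonneg
  have hl : (0 : ℝ) ≤ l := l.cast_nonneg
  have h1 : ∑ j ∈ Finset.range (N + 1), (N.choose j : ℝ≥0∞) *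
      ‖((k : ℂ) - l) ^ j * (1 + (l : ℂ)) ^ (2 * N) * coef E c k l‖ₑ ≤ ENNReal.ofReal t := by
    refine le_trans (Finset.sum_le_sum fun j _ => ?_) h
    gcongr
    exact enorm_le_matrixNorm E
      (fun k l => ((k : ℂ) - l) ^ j * (1 + (l : ℂ)) ^ (2 * N) * coef E c k l) k l
  have e2 : ‖(1 : ℂ) + l‖ = 1 + (l : ℝ) := by
    have : (1 : ℂ) + l = ((1 + l : ℝ) : ℂ) := by push_cast; rfl
    rw [this, Complex.norm_real, Real.norm_of_nonneg (by positivity)]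
  have e1 : ‖(k : ℂ) - l‖ = |(k : ℝ) - l| := by
    have : (k : ℂ) - l = ((k - l : ℝ) : ℂ) := by push_cast; rfl
    rw [this, Complex.norm_real, Real.norm_eq_abs]
  have h2 : ∀ j, (N.choose j : ℝ≥0∞) *
      ‖((k : ℂ) - l) ^ j * (1 + (l : ℂ)) ^ (2 * N) * coef E c k l‖ₑ =
      ENNReal.ofReal ((N.choose j : ℝ) * (|(k : ℝ) - l| ^ j * (1 + (l : ℝ)) ^ (2 * N) *
        ‖coef E c k l‖)) := fun j => by
    rw [ENNReal.ofReal_mul (by positivity), ENNReal.ofReal_natCast, ← ofReal_norm,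
      norm_mul, norm_mul, norm_pow, norm_pow, e1, e2]
  simp only [h2] at h1
  rw [← ENNReal.ofReal_sum_of_nonneg (fun j _ => by positivity),
    ENNReal.ofReal_le_ofReal_iff ht] at h1
  refine le_trans ?_ h1
  have h3 : ∑ j ∈ Finset.range (N + 1), (N.choose j : ℝ) *
      (|(k : ℝ) - l| ^ j * (1 + (l : ℝ)) ^ (2 * N) * ‖coef E c k l‖) =
      (|(k : ℝ) - l| + 1) ^ N * ((1 + (l : ℝ)) ^ (2 * N) * ‖coef E c k l‖) := by
    rw [add_pow |(k : ℝ) - l|, Finset.sum_mul]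
    refine Finset.sum_congr rfl fun j _ => ?_
    ring
  have h4 : 1 + (k : ℝ) ≤ (|(k : ℝ) - l| + 1) * (1 + l) := by
    have := le_abs_self ((k : ℝ) - l)
    nlinarith [mul_nonneg (abs_nonneg ((k : ℝ) - l)) hl]
  rw [h3]
  calc ‖coef E c k l‖ * ((1 + (k : ℝ)) ^ N * (1 + (l : ℝ)) ^ N)
      ≤ ‖coef E c k l‖ * (((|(k : ℝ) - l| + 1) * (1 + l)) ^ N * (1 + (l : ℝ)) ^ N) := by gcongr
    _ = _ := by
        rw [mul_pow]
        ring

theorem toeplitzNorm_eq (E : HilbertBasis ℕ ℂ H) (M N : ℕ) {a : smoothToeplitz E}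
    {f : smoothCircle} {c : H →L[ℂ] H} (hc : c ∈ smoothCompact E)
    (h : (a : H →L[ℂ] H) = toeplitz E f.1 + c) :
    toeplitzNorm E M N a = ENNReal.ofReal
      ((1 / 2 + Real.sqrt ((4 * Real.pi ^ 2 - 9) / 12)) * circleNorm (M + N + 2) f) +
        compactNorm E M N c := by
  refine le_antisymm (iInf_le_of_le f (iInf₂_le (⟨c, hc⟩ : smoothCompact E) h)) ?_
  refine le_iInf fun g => le_iInf₂ fun d h' => ?_
  obtain ⟨h1, h2⟩ := toeplitz_add_injective E hc d.2 (h.symm.trans h')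
  rw [Subtype.ext h1, h2]

theorem toeplitzNorm_add_le (E : HilbertBasis ℕ ℂ H) (M N : ℕ) (a b : smoothToeplitz E) :
    toeplitzNorm E M N (a + b) ≤ toeplitzNorm E M N a + toeplitzNorm E M N b := by
  obtain ⟨f, c, hc, h⟩ := exists_hasSymbol a
  obtain ⟨g, d, hd, h'⟩ := exists_hasSymbol b
  have hab : ((a + b : smoothToeplitz E) : H →L[ℂ] H) = toeplitz E (f + g).1 + (c + d) := by
    rw [Subalgebra.coe_add, Subalgebra.coe_add, toeplitz_add, h, h']
    abel
  rw [toeplitzNorm_eq E M N hc h, toeplitzNorm_eq E M N hd h',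
    toeplitzNorm_eq E M N (add_mem hc hd) hab, add_add_add_comm]
  refine add_le_add ?_ (compactNorm_add_le E M N c d)
  have hS : 0 ≤ 1 / 2 + Real.sqrt ((4 * Real.pi ^ 2 - 9) / 12) := by positivity
  rw [← ENNReal.ofReal_add (mul_nonneg hS (circleNorm_nonneg _ _))
    (mul_nonneg hS (circleNorm_nonneg _ _)), ← mul_add]
  exact ENNReal.ofReal_le_ofReal (mul_le_mul_of_nonneg_left (circleNorm_add_le _ _ _) hS)

/-- The order `M + N + 4` is the `M + N + 2` derivatives of the symbol plus two powers for
summability. Together with `SymbolBound.of_toeplitzNorm_le` this makes the weighted bounds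
equivalent to the Fréchet norms. -/
theorem SymbolBound.toeplitzNorm_le (E : HilbertBasis ℕ ℂ H) (M N : ℕ) :
    ∃ C : ℝ, ∀ (a : smoothToeplitz E) (A : ℝ), SymbolBound E a (M + N + 4) A →
      toeplitzNorm E M N a ≤ ENNReal.ofReal (C * A) := by
  set S := 1 / 2 + Real.sqrt ((4 * Real.pi ^ 2 - 9) / 12) with hS
  have hS0 : 0 ≤ S := by positivity
  set Z := ∑' n : ℤ, ((1 + |(n : ℝ)|) ^ 2)⁻¹ with hZ
  set Y := ∑' p : ℕ × ℕ, ((1 + (p.1 : ℝ)) ^ 2)⁻¹ * ((1 + (p.2 : ℝ)) ^ 2)⁻¹ with hY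
  have hY0 : 0 ≤ Y := tsum_nonneg fun p => by positivity
  refine ⟨S * ((∑ j ∈ Finset.range (M + N + 2 + 1), ((M + N + 2).choose j : ℝ)) * Z) +
    (∑ j ∈ Finset.range (M + 1), (M.choose j : ℝ)) * Y, fun a A h => ?_⟩
  obtain ⟨f, c, hc, h, hf, hc'⟩ := h
  rw [toeplitzNorm_eq E M N hc h]
  have h1 := FourierBound.circleNorm_le (l := M + N + 2) hf
  have h2 := MatrixBound.compactNorm_le (M := M) (N := N) (hc'.mono (by omega) le_rfl)
  refine (add_le_add (ENNReal.ofReal_le_ofReal (mul_le_mul_of_nonneg_left h1 hS0)) h2).trans ?_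
  have hA := hf.nonneg
  have hZ0 : 0 ≤ Z := tsum_nonneg fun p => by positivity
  rw [← ENNReal.ofReal_add (by positivity) (by positivity)]
  refine ENNReal.ofReal_le_ofReal (le_of_eq ?_)
  ring

theorem SymbolBound.of_toeplitzNorm_le {E : HilbertBasis ℕ ℂ H} {N : ℕ} {t : ℝ} (ht : 0 ≤ t)
    {a : smoothToeplitz E} (h : toeplitzNorm E N (2 * N) a ≤ ENNReal.ofReal t) :
    SymbolBound E a N (4 * 2 ^ N * t) := by
  obtain ⟨f, c, hc, h'⟩ := exists_hasSymbol a
  rw [toeplitzNorm_eq E _ _ hc h'] at h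
  have h1 := (ENNReal.ofReal_le_ofReal_iff ht).1 (le_self_add.trans h)
  have h2 := matrixBound_of_compactNorm_le ht (le_add_self.trans h)
  -- The only property of `S` that matters here is `S ≥ 1/2`.
  have h3 : 1 / 2 * circleNorm (N + 2 * N + 2) f ≤ t := by
    refine le_trans (mul_le_mul_of_nonneg_right ?_ (circleNorm_nonneg _ _)) h1
    exact le_add_of_nonneg_right (Real.sqrt_nonneg _)
  refine ⟨f, c, hc, h', ?_, h2.mono le_rfl ?_⟩
  · refine (fourierBound_of_circleNorm (l := N + 2 * N + 2) (by omega)).mono le_rfl ?_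
    have : (0 : ℝ) < 2 ^ N := by positivity
    nlinarith
  · have : (1 : ℝ) ≤ 2 ^ N := one_le_pow₀ (by norm_num)
    nlinarith

/-- By linearity it is enough to bound each norm of `φ a` by a constant times some norm of `a`; the
triangle inequality then gives openness of preimages of balls with arbitrary centres. -/
theorem IsTame.continuous {E : HilbertBasis ℕ ℂ H} {φ : smoothToeplitz E →ₗ[ℂ] smoothToeplitz E}
    (h : IsTame E φ) : IsFrechetContinuous E φ := by
  have hlip : ∀ M N, ∃ (K : ℕ) (C : ℝ), 0 < C ∧ ∀ (a : smoothToeplitz E) (t : ℝ), 0 ≤ t →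
      toeplitzNorm E K (2 * K) a ≤ ENNReal.ofReal t →
        toeplitzNorm E M N (φ a) ≤ ENNReal.ofReal (C * t) := by
    intro M N
    obtain ⟨C, hC⟩ := SymbolBound.toeplitzNorm_le E M N
    obtain ⟨K, C', hC'⟩ := h (M + N + 4)
    -- The constants carry no sign information; the absolute value plus one makes the result
    -- positive, so that it can be divided by.
    refine ⟨K, |C * (C' * (4 * 2 ^ K))| + 1, by positivity, fun a t ht ha => ?_⟩
    refine (hC _ _ (hC' _ _ (SymbolBound.of_toeplitzNorm_le ht ha))).trans ?_
    refine ENNReal.ofReal_le_ofReal ?_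
    calc C * (C' * (4 * 2 ^ K * t)) = C * (C' * (4 * 2 ^ K)) * t := by ring
      _ ≤ _ := mul_le_mul_of_nonneg_right (by linarith [le_abs_self (C * (C' * (4 * 2 ^ K)))]) ht
  refine continuous_generateFrom_iff.2 ?_
  rintro _ ⟨M, N, a, ε, hε, rfl⟩
  obtain ⟨K, C, hC, hK⟩ := hlip M N
  refine (@isOpen_iff_forall_mem_open _ (frechetTopology E) _).2 ?_
  intro b hb
  change toeplitzNorm E M N (φ b - a) < ε at hb
  -- `q` lies strictly between `0` and the gap `ε - ‖φ b - a‖`; the ball of radius `q / C` around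
  -- `b` is mapped into the given one.
  obtain ⟨q, hq0, hq⟩ := ENNReal.lt_iff_exists_nnreal_btwn.1 (tsub_pos_of_lt hb)
  have hq0' : (0 : ℝ) < q := by exact_mod_cast hq0
  have ht : 0 < (q : ℝ) / C := by positivity
  refine ⟨{x | toeplitzNorm E K (2 * K) (x - b) < ENNReal.ofReal (q / C)}, fun x hx => ?_,
    TopologicalSpace.isOpen_generateFrom_of_mem
      ⟨K, 2 * K, b, _, ENNReal.ofReal_pos.2 ht, rfl⟩, ?_⟩
  · have h1 := hK _ _ ht.le (le_of_lt hx)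
    rw [mul_div_cancel₀ _ hC.ne', ENNReal.ofReal_coe_nnreal] at h1
    change toeplitzNorm E M N (φ x - a) < ε
    have h2 : φ x - a = φ (x - b) + (φ b - a) := by
      rw [map_sub]
      abel
    rw [h2]
    refine ((toeplitzNorm_add_le E M N _ _).trans (add_le_add_left h1 _)).trans_lt ?_
    exact lt_tsub_iff_right.1 hq
  · change toeplitzNorm E K (2 * K) (b - b) < _
    obtain ⟨C', hC'⟩ := SymbolBound.toeplitzNorm_le E K (2 * K)
    refine (hC' _ 0 ?_).trans_lt (by rw [mul_zero]; simpa using ht)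
    rw [sub_self]
    exact symbolBound_zero E _

theorem IsTame.add {E : HilbertBasis ℕ ℂ H} {φ ψ : smoothToeplitz E →ₗ[ℂ] smoothToeplitz E}
    (hφ : IsTame E φ) (hψ : IsTame E ψ) : IsTame E (φ + ψ) := by
  intro N
  obtain ⟨M, C, h⟩ := hφ N
  obtain ⟨M', C', h'⟩ := hψ N
  refine ⟨max M M', C + C', fun a A ha => ?_⟩
  rw [add_mul]
  exact (h a A (ha.mono (le_max_left _ _) le_rfl)).add
    (h' a A (ha.mono (le_max_right _ _) le_rfl))

theorem IsTame.comp {E : HilbertBasis ℕ ℂ H} {φ ψ : smoothToeplitz E →ₗ[ℂ] smoothToeplitz E}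
    (hφ : IsTame E φ) (hψ : IsTame E ψ) : IsTame E (φ ∘ₗ ψ) := by
  intro N
  obtain ⟨M, C, h⟩ := hφ N
  obtain ⟨M', C', h'⟩ := hψ M
  refine ⟨M', C * C', fun a A ha => ?_⟩
  rw [mul_assoc]
  exact h _ _ (h' a A ha)

theorem isTame_mulLeft {E : HilbertBasis ℕ ℂ H} (a : smoothToeplitz E) :
    IsTame E (LinearMap.mulLeft ℂ a) := by
  intro N
  obtain ⟨C, hC⟩ := SymbolBound.mul (H := H) N
  obtain ⟨B, hB⟩ := exists_symbolBound a (N + 2)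
  exact ⟨N + 2, C * B, fun b A hb => hC E a b B A hB hb⟩

/-- The commutator with an element of the smooth Toeplitz algebra. -/
def commutator {E : HilbertBasis ℕ ℂ H} (a : smoothToeplitz E) :
    smoothToeplitz E →ₗ[ℂ] smoothToeplitz E :=
  LinearMap.mulLeft ℂ a - LinearMap.mulRight ℂ a

theorem commutator_apply {E : HilbertBasis ℕ ℂ H} (a b : smoothToeplitz E) :
    commutator a b = a * b - b * a := rfl

theorem isTame_commutator {E : HilbertBasis ℕ ℂ H} (a : smoothToeplitz E) :
    IsTame E (commutator a) := by
  intro N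
  obtain ⟨C, hC⟩ := SymbolBound.mul (H := H) N
  obtain ⟨B, hB⟩ := exists_symbolBound a (N + 2)
  refine ⟨N + 2, C * B + C * B, fun b A hb => ?_⟩
  rw [commutator_apply, Subalgebra.coe_sub, sub_eq_add_neg, add_mul]
  have h2 := (hC E b a A B hb hB).neg
  rw [mul_right_comm] at h2
  exact (hC E a b B A hB hb).add h2

/-! ### Commutators with the number operator -/

theorem toeplitz_mem (E : HilbertBasis ℕ ℂ H) (f : smoothCircle) :
    toeplitz E f.1 ∈ smoothToeplitz E :=
  ⟨f.1, f.2, 0, zero_mem _, (add_zero _).symm⟩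

/-- The Toeplitz operator of a smooth function as an element of the smooth Toeplitz algebra. -/
def smoothToeplitzOf (E : HilbertBasis ℕ ℂ H) (f : smoothCircle) : smoothToeplitz E :=
  ⟨toeplitz E f.1, toeplitz_mem E f⟩

theorem hasSymbol_smoothToeplitzOf (E : HilbertBasis ℕ ℂ H) (f : smoothCircle) :
    HasSymbol E (smoothToeplitzOf E f) f :=
  ⟨0, zero_mem _, (add_zero _).symm⟩

theorem mem_smoothToeplitz_of_mem_smoothCompact {E : HilbertBasis ℕ ℂ H} {c : H →L[ℂ] H}
    (hc : c ∈ smoothCompact E) : c ∈ smoothToeplitz E :=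
  ⟨0, zero_mem _, c, hc, by rw [toeplitz_zero, zero_add]⟩

theorem MatrixBound.symbolBound {E : HilbertBasis ℕ ℂ H} {c : H →L[ℂ] H}
    (hc : c ∈ smoothCompact E) {N : ℕ} {A : ℝ} (h : MatrixBound (coef E c) N A) :
    SymbolBound E c N A := by
  refine ⟨0, c, hc, by rw [Subalgebra.coe_zero, toeplitz_zero, zero_add], fun n => ?_, h⟩
  rw [Subalgebra.coe_zero, ← fourierCoeffL_apply]
  simpa using h.nonneg

/-- By uniqueness of the decomposition, the compact part supplied by the bound is `c` itself. -/
theorem SymbolBound.matrixBound {E : HilbertBasis ℕ ℂ H} {c : H →L[ℂ] H} {N : ℕ} {A : ℝ}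
    (h : SymbolBound E c N A) (hc : c ∈ smoothCompact E) : MatrixBound (coef E c) N A := by
  obtain ⟨f, d, hd, h, -, hb⟩ := h
  have := (toeplitz_add_injective E (f := 0) (g := f.1) hc hd
    (by rw [toeplitz_zero, zero_add, h])).2
  rwa [this]

/-- Used with the weight `k - l` of `[𝕂, ·]` and the weight `l` of right multiplication by `𝕂`. -/
theorem MatrixBound.mul_weight {w c : ℕ → ℕ → ℂ} {N : ℕ} {A : ℝ}
    (hw : ∀ k l : ℕ, ‖w k l‖ ≤ (1 + (k : ℝ)) * (1 + l)) (h : MatrixBound c (N + 1) A) :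
    MatrixBound (fun k l => w k l * c k l) N A := fun k l => by
  refine le_trans ?_ (h k l)
  rw [norm_mul]
  calc ‖w k l‖ * ‖c k l‖ * ((1 + (k : ℝ)) ^ N * (1 + (l : ℝ)) ^ N)
      ≤ ((1 + (k : ℝ)) * (1 + l)) * ‖c k l‖ * ((1 + (k : ℝ)) ^ N * (1 + (l : ℝ)) ^ N) := by
        gcongr
        exact hw k l
    _ = _ := by ring

theorem norm_natCast_sub_le (k l : ℕ) : ‖(k : ℂ) - l‖ ≤ (1 + (k : ℝ)) * (1 + l) := by
  have hk : (0 : ℝ) ≤ k := k.cast_nonneg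
  have hl : (0 : ℝ) ≤ l := l.cast_nonneg
  have : ‖(k : ℂ) - l‖ ≤ k + l := by
    refine (norm_sub_le _ _).trans ?_
    simp
  nlinarith [mul_nonneg hk hl]

theorem norm_natCast_le_mul (k l : ℕ) : ‖(l : ℂ)‖ ≤ (1 + (k : ℝ)) * (1 + l) := by
  have hk : (0 : ℝ) ≤ k := k.cast_nonneg
  have hl : (0 : ℝ) ≤ l := l.cast_nonneg
  rw [Complex.norm_natCast]
  nlinarith [mul_nonneg hk hl]

theorem exists_weighted_mem {E : HilbertBasis ℕ ℂ H} {w : ℕ → ℕ → ℂ}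
    (hw : ∀ k l : ℕ, ‖w k l‖ ≤ (1 + (k : ℝ)) * (1 + l)) {c : H →L[ℂ] H}
    (hc : c ∈ smoothCompact E) :
    ∃ d ∈ smoothCompact E, ∀ k l, coef E d k l = w k l * coef E c k l :=
  exists_smoothCompact_coef E fun N => by
    obtain ⟨A, hA⟩ := exists_matrixBound hc (N + 1)
    exact ⟨A, hA.mul_weight hw⟩

theorem coef_toeplitz_circleDeriv (E : HilbertBasis ℕ ℂ H) (f : smoothCircle) (k l : ℕ) :
    coef E (toeplitz E (circleDeriv f).1) k l = ((k : ℂ) - l) * coef E (toeplitz E f.1) k l := by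
  rw [coef_toeplitz, coef_toeplitz, fourierCoeff_circleDeriv]
  push_cast
  ring

theorem exists_numberDeriv {E : HilbertBasis ℕ ℂ H} {a : H →L[ℂ] H} {f : smoothCircle}
    {c : H →L[ℂ] H} (hc : c ∈ smoothCompact E) (h : a = toeplitz E f.1 + c) :
    ∃ d ∈ smoothCompact E, (∀ k l, coef E d k l = ((k : ℂ) - l) * coef E c k l) ∧
      ∀ k l, coef E (toeplitz E (circleDeriv f).1 + d) k l = ((k : ℂ) - l) * coef E a k l := by
  obtain ⟨d, hd, hd'⟩ := exists_weighted_mem norm_natCast_sub_le hc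
  refine ⟨d, hd, hd', fun k l => ?_⟩
  rw [h, coef_add, coef_add, hd', coef_toeplitz_circleDeriv]
  ring

/-- The linear map which multiplies the matrix of `ψ a` entrywise by the weights `w`. -/
def weightedMap {E : HilbertBasis ℕ ℂ H} (ψ : smoothToeplitz E →ₗ[ℂ] smoothToeplitz E)
    (w : ℕ → ℕ → ℂ)
    (h : ∀ a, ∃ b : smoothToeplitz E, ∀ k l, coef E b k l = w k l * coef E (ψ a) k l) :
    smoothToeplitz E →ₗ[ℂ] smoothToeplitz E where
  toFun a := (h a).choose
  map_add' a b := by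
    refine Subtype.ext (coef_ext E fun k l => ?_)
    rw [Subalgebra.coe_add, coef_add, (h a).choose_spec, (h b).choose_spec,
      (h (a + b)).choose_spec, map_add, Subalgebra.coe_add, coef_add, mul_add]
  map_smul' r a := by
    refine Subtype.ext (coef_ext E fun k l => ?_)
    rw [RingHom.id_apply, Subalgebra.coe_smul, coef_smul, (h a).choose_spec,
      (h (r • a)).choose_spec, map_smul, Subalgebra.coe_smul, coef_smul, mul_left_comm]

theorem coef_weightedMap {E : HilbertBasis ℕ ℂ H}
    {ψ : smoothToeplitz E →ₗ[ℂ] smoothToeplitz E} {w : ℕ → ℕ → ℂ}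
    (h : ∀ a, ∃ b : smoothToeplitz E, ∀ k l, coef E b k l = w k l * coef E (ψ a) k l)
    (a : smoothToeplitz E) (k l : ℕ) :
    coef E (weightedMap ψ w h a) k l = w k l * coef E (ψ a) k l :=
  (h a).choose_spec k l

/-- The derivation `a ↦ [𝕂, a]`. -/
def numberDeriv (E : HilbertBasis ℕ ℂ H) : smoothToeplitz E →ₗ[ℂ] smoothToeplitz E :=
  weightedMap LinearMap.id (fun k l => (k : ℂ) - l) fun a => by
    obtain ⟨f, c, hc, h⟩ := exists_hasSymbol a
    obtain ⟨d, hd, -, h'⟩ := exists_numberDeriv hc h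
    exact ⟨⟨_, _, (circleDeriv f).2, d, hd, rfl⟩, h'⟩

theorem coef_numberDeriv {E : HilbertBasis ℕ ℂ H} (a : smoothToeplitz E) (k l : ℕ) :
    coef E (numberDeriv E a) k l = ((k : ℂ) - l) * coef E a k l :=
  coef_weightedMap _ a k l

theorem HasSymbol.numberDeriv {E : HilbertBasis ℕ ℂ H} {a : smoothToeplitz E} {f : smoothCircle}
    (h : HasSymbol E a f) : HasSymbol E (numberDeriv E a) (circleDeriv f) := by
  obtain ⟨c, hc, h⟩ := h
  obtain ⟨d, hd, -, h'⟩ := exists_numberDeriv hc h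
  exact ⟨d, hd, coef_ext E fun k l => (coef_numberDeriv a k l).trans (h' k l).symm⟩

theorem isTame_numberDeriv (E : HilbertBasis ℕ ℂ H) : IsTame E (numberDeriv E) := by
  refine fun N => ⟨N + 1, 1, fun a A h => ?_⟩
  obtain ⟨f, c, hc, h, hf, hb⟩ := h
  obtain ⟨d, hd, hd', h'⟩ := exists_numberDeriv hc h
  rw [one_mul]
  refine ⟨circleDeriv f, d, hd,
    coef_ext E fun k l => (coef_numberDeriv a k l).trans (h' k l).symm, ?_, ?_⟩
  · rw [funext (fourierCoeff_circleDeriv f)]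
    exact hf.intCast_mul
  · rw [funext₂ hd']
    exact hb.mul_weight norm_natCast_sub_le

/-- The map `b ↦ [a, b] 𝕂`. -/
def commutatorNumber {E : HilbertBasis ℕ ℂ H} (a : smoothToeplitz E) :
    smoothToeplitz E →ₗ[ℂ] smoothToeplitz E :=
  weightedMap (commutator a) (fun _ l => (l : ℂ)) fun b => by
    obtain ⟨d, hd, hd'⟩ := exists_weighted_mem norm_natCast_le_mul
      (commutator_mem_smoothCompact a b)
    exact ⟨⟨d, mem_smoothToeplitz_of_mem_smoothCompact hd⟩, hd'⟩

theorem coef_commutatorNumber {E : HilbertBasis ℕ ℂ H} (a b : smoothToeplitz E) (k l : ℕ) :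
    coef E (commutatorNumber a b) k l =
      l * coef E (a * b - b * a : smoothToeplitz E) k l :=
  coef_weightedMap _ b k l

theorem commutatorNumber_mem {E : HilbertBasis ℕ ℂ H} (a b : smoothToeplitz E) :
    (commutatorNumber a b : H →L[ℂ] H) ∈ smoothCompact E := by
  obtain ⟨d, hd, hd'⟩ := exists_weighted_mem norm_natCast_le_mul
    (commutator_mem_smoothCompact a b)
  rwa [coef_ext E fun k l => (coef_commutatorNumber a b k l).trans (hd' k l).symm]

theorem isTame_commutatorNumber {E : HilbertBasis ℕ ℂ H} (a : smoothToeplitz E) :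
    IsTame E (commutatorNumber a) := by
  intro N
  obtain ⟨M, C, h⟩ := isTame_commutator a (N + 1)
  refine ⟨M, C, fun b A hb => MatrixBound.symbolBound (commutatorNumber_mem a b) ?_⟩
  rw [funext₂ (coef_commutatorNumber a b)]
  exact ((h b A hb).matrixBound (commutator_mem_smoothCompact a b)).mul_weight norm_natCast_le_mul

/-! ### The number operator and its domain -/

theorem hasSum_coef_mul_repr (E : HilbertBasis ℕ ℂ H) (a : H →L[ℂ] H) (x : H) (k : ℕ) :
    HasSum (fun l => coef E a k l * E.repr x l) (E.repr (a x) k) := by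
  have := E.hasSum_inner_mul_inner (adjoint a (E k)) x
  simp only [adjoint_inner_left] at this
  simpa only [coef, E.repr_apply_apply] using this

theorem repr_numberOp (E : HilbertBasis ℕ ℂ H) (x : (numberOp E).domain) (k : ℕ) :
    E.repr (numberOp E x) k = k * E.repr (x : H) k := by
  change E.repr (E.repr.symm _) k = _
  rw [LinearIsometryEquiv.apply_symm_apply]

/-- The domain of `𝕂` is maximal: square summability of the coordinates of `y` is the membership
condition for `x`. -/
theorem numberOp_eq_of_repr {E : HilbertBasis ℕ ℂ H} {x y : H}
    (h : ∀ k, E.repr y k = k * E.repr x k) :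
    ∃ hx : x ∈ (numberOp E).domain, numberOp E ⟨x, hx⟩ = y := by
  have hx : x ∈ (numberOp E).domain := by
    have h1 := lp.memℓp (E.repr y)
    rw [funext h] at h1
    exact h1
  refine ⟨hx, E.repr.injective ?_⟩
  ext k
  exact (repr_numberOp E ⟨x, hx⟩ k).trans (h k).symm

theorem basis_mem_numberDomain (E : HilbertBasis ℕ ℂ H) (l : ℕ) : E l ∈ (numberOp E).domain := by
  refine (numberOp_eq_of_repr (y := (l : ℂ) • E l) fun k => ?_).1
  rw [map_smul, E.repr_self, lp.coeFn_smul, Pi.smul_apply, smul_eq_mul, lp.single_apply,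
    Pi.single_apply]
  split_ifs with h
  · rw [h]
  · simp

/-- In coordinates, `k a_{k,l} x_l = a_{k,l} (l x_l) + (k - l) a_{k,l} x_l`. Both series on the
right converge, because `𝕂x` and `x` are vectors of `H`, and they sum to coordinates of a vector;
hence `a` preserves the domain. -/
theorem numberOp_apply_eq {E : HilbertBasis ℕ ℂ H} {a b : H →L[ℂ] H}
    (h : ∀ k l, coef E b k l = ((k : ℂ) - l) * coef E a k l) (x : (numberOp E).domain) :
    ∃ hx : a (x : H) ∈ (numberOp E).domain,
      numberOp E ⟨a x, hx⟩ = a (numberOp E x) + b (x : H) := by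
  refine numberOp_eq_of_repr fun k => ?_
  have h1 := hasSum_coef_mul_repr E a (numberOp E x) k
  have h2 := hasSum_coef_mul_repr E b (x : H) k
  have h3 := (hasSum_coef_mul_repr E a (x : H) k).mul_left (k : ℂ)
  rw [map_add, lp.coeFn_add, Pi.add_apply]
  refine (h1.add h2).unique (h3.congr_fun fun l => ?_)
  rw [repr_numberOp, h]
  ring

theorem apply_numberOp_eq {E : HilbertBasis ℕ ℂ H} {c d : H →L[ℂ] H}
    (h : ∀ k l : ℕ, coef E d k l = l * coef E c k l) (x : (numberOp E).domain) :
    c (numberOp E x) = d (x : H) := by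
  refine E.repr.injective ?_
  ext k
  refine (hasSum_coef_mul_repr E c (numberOp E x) k).unique
    ((hasSum_coef_mul_repr E d (x : H) k).congr_fun fun l => ?_)
  rw [repr_numberOp, h]
  ring

theorem numberDeriv_apply {E : HilbertBasis ℕ ℂ H} (a : smoothToeplitz E) (x : (numberOp E).domain) :
    ∃ hx : a.1 (x : H) ∈ (numberOp E).domain,
      numberOp E ⟨a.1 x, hx⟩ = a.1 (numberOp E x) + (numberDeriv E a).1 (x : H) :=
  numberOp_apply_eq (coef_numberDeriv a) x

/-! ### The derivation of a vector field -/

/-- The bounded operator `[𝕂, T(F_-)]`. -/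
def numberNegFreqPart (E : HilbertBasis ℕ ℂ H) (F : smoothCircle) : smoothToeplitz E :=
  smoothToeplitzOf E (circleDeriv ⟨negFreqPart F, negFreqPart_mem F⟩)

theorem compPMap_add_compBounded_apply (s t : H →L[ℂ] H) (D : H →ₗ.[ℂ] H) {x : H}
    (h1 : x ∈ D.domain) (h2 : t x ∈ D.domain) :
    ∃ hx : x ∈ ((s : H →ₗ[ℂ] H).compPMap D + compBounded D t).domain,
      ((s : H →ₗ[ℂ] H).compPMap D + compBounded D t) ⟨x, hx⟩ = s (D ⟨x, h1⟩) + D ⟨t x, h2⟩ :=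
  ⟨⟨h1, h2⟩, rfl⟩

theorem numberOp_toeplitz_negFreqPart {E : HilbertBasis ℕ ℂ H} (F : smoothCircle)
    (x : (numberOp E).domain) : ∃ hx : toeplitz E (negFreqPart F) (x : H) ∈ (numberOp E).domain,
      numberOp E ⟨toeplitz E (negFreqPart F) x, hx⟩ =
        toeplitz E (negFreqPart F) (numberOp E x) + (numberNegFreqPart E F).1 (x : H) :=
  numberOp_apply_eq (coef_toeplitz_circleDeriv E ⟨negFreqPart F, negFreqPart_mem F⟩) x

/-- `T(F_-)` preserves the domain of `𝕂`, so `𝕂T(F_-) = T(F_-)𝕂 + [𝕂, T(F_-)]` there, and `T(F_+) +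
T(F_-) = T(F)`. -/
theorem vectorFieldOp_apply {E : HilbertBasis ℕ ℂ H} {F : smoothCircle} (x : (numberOp E).domain) :
    ∃ hx : (x : H) ∈ (vectorFieldOp E F).domain, vectorFieldOp E F ⟨x, hx⟩ =
      (smoothToeplitzOf E F).1 (numberOp E x) + (numberNegFreqPart E F).1 (x : H) := by
  obtain ⟨h1, h2⟩ := numberOp_toeplitz_negFreqPart F x
  obtain ⟨h3, h4⟩ := compPMap_add_compBounded_apply (toeplitz E (nonnegFreqPart F))
    (toeplitz E (negFreqPart F)) (numberOp E) x.2 h1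
  refine ⟨h3, h4.trans ?_⟩
  have h5 : (smoothToeplitzOf E F).1 =
      toeplitz E (nonnegFreqPart F) + toeplitz E (negFreqPart F) := by
    rw [← toeplitz_add, nonnegFreqPart_add_negFreqPart]
    rfl
  rw [h2, ← add_assoc, h5, add_apply]

theorem mem_numberDomain_of_mem_vectorFieldOp {E : HilbertBasis ℕ ℂ H} {F : smoothCircle} {x : H}
    (hx : x ∈ (vectorFieldOp E F).domain) : x ∈ (numberOp E).domain :=
  hx.1

/-- The derivation `δ_F`. -/
def vectorFieldDeriv (E : HilbertBasis ℕ ℂ H) (F : smoothCircle) :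
    smoothToeplitz E →ₗ[ℂ] smoothToeplitz E :=
  LinearMap.mulLeft ℂ (smoothToeplitzOf E F) ∘ₗ numberDeriv E +
    commutatorNumber (smoothToeplitzOf E F) + commutator (numberNegFreqPart E F)

theorem vectorFieldDeriv_apply {E : HilbertBasis ℕ ℂ H} (F : smoothCircle) (a : smoothToeplitz E)
    (x : H) : (vectorFieldDeriv E F a).1 x =
      (smoothToeplitzOf E F).1 ((numberDeriv E a).1 x) +
        (commutatorNumber (smoothToeplitzOf E F) a).1 x +
        ((numberNegFreqPart E F).1 (a.1 x) - a.1 ((numberNegFreqPart E F).1 x)) :=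
  rfl

/-- On the domain, `T(F)𝕂a - aT(F)𝕂 = T(F)[𝕂, a] + [T(F), a]𝕂`; the rest of the operator is bounded
and contributes an ordinary commutator. -/
theorem isDeltaF_vectorFieldDeriv (E : HilbertBasis ℕ ℂ H) (F : smoothCircle) :
    IsDeltaF E F (vectorFieldDeriv E F) := by
  rintro a ⟨x, hxD⟩
  have hx := mem_numberDomain_of_mem_vectorFieldOp hxD
  obtain ⟨h1, h2⟩ := numberDeriv_apply a ⟨x, hx⟩
  obtain ⟨h3, h4⟩ := vectorFieldOp_apply (F := F) (⟨x, hx⟩ : (numberOp E).domain)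
  obtain ⟨h5, h6⟩ := vectorFieldOp_apply (F := F) (⟨_, h1⟩ : (numberOp E).domain)
  refine ⟨h5, ?_⟩
  have h7 := apply_numberOp_eq (coef_commutatorNumber (smoothToeplitzOf E F) a) ⟨x, hx⟩
  rw [Subalgebra.coe_sub, Subalgebra.coe_mul, Subalgebra.coe_mul] at h7
  change (smoothToeplitzOf E F).1 (a.1 (numberOp E ⟨x, hx⟩)) -
    a.1 ((smoothToeplitzOf E F).1 (numberOp E ⟨x, hx⟩)) = _ at h7
  rw [vectorFieldDeriv_apply]
  refine Eq.trans ?_ (congrArg₂ (fun u v => u - a.1 v) h6 h4).symm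
  dsimp only at h2 h7 ⊢
  rw [h2, ← h7, map_add, map_add]
  abel

/-- The domain contains the basis vectors, and a bounded operator is determined by its values on
them. -/
theorem IsDeltaF.unique {E : HilbertBasis ℕ ℂ H} {F : smoothCircle}
    {δ δ' : smoothToeplitz E →ₗ[ℂ] smoothToeplitz E} (h : IsDeltaF E F δ)
    (h' : IsDeltaF E F δ') : δ = δ' := by
  refine LinearMap.ext fun a => Subtype.ext (coef_ext E fun k l => ?_)
  obtain ⟨hx, -⟩ := vectorFieldOp_apply (F := F)
    (⟨E l, basis_mem_numberDomain E l⟩ : (numberOp E).domain)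
  obtain ⟨_, h1⟩ := h a ⟨E l, hx⟩
  obtain ⟨_, h2⟩ := h' a ⟨E l, hx⟩
  exact congrArg (inner ℂ (E k)) (h1.trans h2.symm)

theorem IsDeltaF.isDerivation {E : HilbertBasis ℕ ℂ H} {F : smoothCircle}
    {δ : smoothToeplitz E →ₗ[ℂ] smoothToeplitz E} (h : IsDeltaF E F δ) : IsDerivation E δ := by
  refine fun a b => Subtype.ext (coef_ext E fun k l => ?_)
  obtain ⟨hx, -⟩ := vectorFieldOp_apply (F := F)
    (⟨E l, basis_mem_numberDomain E l⟩ : (numberOp E).domain)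
  obtain ⟨h1, h2⟩ := h b ⟨E l, hx⟩
  obtain ⟨h3, h4⟩ := h a ⟨_, h1⟩
  obtain ⟨h5, h6⟩ := h (a * b) ⟨E l, hx⟩
  refine congrArg (inner ℂ (E k)) (h6.trans ?_)
  change _ = a.1 ((δ b).1 (E l)) + (δ a).1 (b.1 (E l))
  rw [h2, h4, map_sub]
  change vectorFieldOp E F ⟨a.1 (b.1 (E l)), h3⟩ - a.1 (b.1 _) = _
  abel

theorem isTame_vectorFieldDeriv (E : HilbertBasis ℕ ℂ H) (F : smoothCircle) :
    IsTame E (vectorFieldDeriv E F) :=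
  (((isTame_mulLeft _).comp (isTame_numberDeriv E)).add (isTame_commutatorNumber _)).add
    (isTame_commutator _)

/-- Only `T(F)[𝕂, a]` has a nonzero symbol; the other two terms are smooth compact. -/
theorem HasSymbol.vectorFieldDeriv {E : HilbertBasis ℕ ℂ H} (F : smoothCircle)
    {a : smoothToeplitz E} {f : smoothCircle} (h : HasSymbol E a f) :
    HasSymbol E (vectorFieldDeriv E F a) (F * circleDeriv f) := by
  have h1 := (hasSymbol_smoothToeplitzOf E F).mul h.numberDeriv
  have h2 := h1.add (hasSymbol_zero_iff.2 (commutatorNumber_mem (smoothToeplitzOf E F) a))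
  have h3 := h2.add (hasSymbol_zero_iff.2 (commutator_mem_smoothCompact (numberNegFreqPart E F) a))
  rwa [add_zero, add_zero] at h3

/-! ### Matrices that satisfy a recurrence along the diagonals -/

/-- Minus the sum of all later increments is the solution of the diagonal recurrence that vanishes
at infinity. The extra power in each of the two indices yields one factor `1 + i`, and their product
makes the series converge. -/
theorem MatrixBound.neg_tsum_diagonal {c : ℕ → ℕ → ℂ} {N : ℕ} {A : ℝ}
    (h : MatrixBound c (N + 1) A) :
    MatrixBound (fun k l => -∑' i : ℕ, c (k + 1 + i) (l + i)) N
      (A * ∑' n : ℕ, ((1 + (n : ℝ)) ^ 2)⁻¹) := fun k l => by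
  have hkl : 0 < (1 + (k : ℝ)) ^ N * (1 + (l : ℝ)) ^ N := by positivity
  rw [← le_div_iff₀ hkl, norm_neg]
  refine tsum_of_norm_bounded ((summable_inv_sq.hasSum.mul_left A).div_const _) fun i => ?_
  rw [le_div_iff₀ hkl, ← div_eq_mul_inv, le_div_iff₀ (by positivity)]
  refine le_trans ?_ (h (k + 1 + i) (l + i))
  push_cast
  have e1 : (1 + (k : ℝ)) ^ N * (1 + i) ≤ (1 + ((k : ℝ) + 1 + i)) ^ (N + 1) := by
    rw [pow_succ]
    gcongr <;> linarith [(k.cast_nonneg : (0 : ℝ) ≤ k), (i.cast_nonneg : (0 : ℝ) ≤ i)]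
  have e2 : (1 + (l : ℝ)) ^ N * (1 + i) ≤ (1 + ((l : ℝ) + i)) ^ (N + 1) := by
    rw [pow_succ]
    gcongr <;> linarith [(l.cast_nonneg : (0 : ℝ) ≤ l), (i.cast_nonneg : (0 : ℝ) ≤ i)]
  calc ‖c (k + 1 + i) (l + i)‖ * ((1 + (k : ℝ)) ^ N * (1 + (l : ℝ)) ^ N) * (1 + (i : ℝ)) ^ 2
      = ‖c (k + 1 + i) (l + i)‖ * (((1 + (k : ℝ)) ^ N * (1 + i)) * ((1 + (l : ℝ)) ^ N * (1 + i))) := by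
        ring
    _ ≤ _ := by gcongr

theorem MatrixBound.neg_tsum_diagonal_succ {c : ℕ → ℕ → ℂ} {A : ℝ} (h : MatrixBound c 1 A)
    (k l : ℕ) : -∑' i : ℕ, c (k + 1 + 1 + i) (l + 1 + i) =
      -(∑' i : ℕ, c (k + 1 + i) (l + i)) + c (k + 1) l := by
  have hs : Summable fun i : ℕ => c (k + 1 + i) (l + i) := by
    refine Summable.of_norm_bounded (summable_inv_sq.mul_left A) fun i => ?_
    rw [← div_eq_mul_inv, le_div_iff₀ (by positivity)]
    refine le_trans ?_ (h (k + 1 + i) (l + i))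
    push_cast
    rw [pow_one, pow_one, sq]
    gcongr <;> linarith [(k.cast_nonneg : (0 : ℝ) ≤ k), (l.cast_nonneg : (0 : ℝ) ≤ l)]
  rw [hs.tsum_eq_zero_add]
  have : ∀ i : ℕ, c (k + 1 + 1 + i) (l + 1 + i) = c (k + 1 + (i + 1)) (l + (i + 1)) := fun i => by
    congr 1 <;> ring
  simp only [this, add_zero]
  ring

theorem eq_of_diagonal_const {b : ℕ → ℕ → ℂ} (h : ∀ k l, b (k + 1) (l + 1) = b k l) (k l : ℕ) :
    b k l = b ((k : ℤ) - l).toNat (-((k : ℤ) - l)).toNat := by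
  have key : ∀ m k l, b (k + m) (l + m) = b k l := by
    intro m
    induction m with
    | zero => simp
    | succ m ih => exact fun k l => (h (k + m) (l + m)).trans (ih k l)
  have := key (min k l) ((k : ℤ) - l).toNat (-((k : ℤ) - l)).toNat
  rw [← this]
  congr 1 <;> omega

/-- A matrix whose increments along the diagonals, first row and first column decay rapidly is the
matrix of an element of the smooth Toeplitz algebra. -/
theorem exists_coef_eq_of_diagonal (E : HilbertBasis ℕ ℂ H) {L c : ℕ → ℕ → ℂ}
    (hc : ∀ N, ∃ A, MatrixBound c N A)
    (hcol : ∀ N, ∃ A : ℝ, ∀ k : ℕ, ‖L k 0‖ * (1 + (k : ℝ)) ^ N ≤ A)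
    (hrow : ∀ N, ∃ A : ℝ, ∀ l : ℕ, ‖L 0 l‖ * (1 + (l : ℝ)) ^ N ≤ A)
    (hL : ∀ k l, L (k + 1) (l + 1) = L k l + c (k + 1) l) :
    ∃ B : smoothToeplitz E, ∀ k l, coef E B k l = L k l := by
  set γ : ℕ → ℕ → ℂ := fun k l => -∑' i : ℕ, c (k + 1 + i) (l + i) with hγ
  have hγ' : ∀ N, ∃ A, MatrixBound γ N A := fun N => by
    obtain ⟨A, hA⟩ := hc (N + 1)
    exact ⟨_, hA.neg_tsum_diagonal⟩
  -- `L` and `γ` satisfy the same recurrence, so `L - γ` is constant along diagonals, that is, a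
  -- Toeplitz matrix.
  have hdiag : ∀ k l, L (k + 1) (l + 1) - γ (k + 1) (l + 1) = L k l - γ k l := fun k l => by
    obtain ⟨A, hA⟩ := hc 1
    simp only [hL, hγ, hA.neg_tsum_diagonal_succ]
    ring
  -- Each diagonal meets the first column (`n ≥ 0`) or the first row (`n ≤ 0`), where the Fourier
  -- coefficients of the symbol are read off.
  have hβ : ∀ N, ∃ A, FourierBound (fun n : ℤ => L n.toNat (-n).toNat - γ n.toNat (-n).toNat) N A := by
    intro N
    obtain ⟨A, hA⟩ := hγ' N
    obtain ⟨A₁, hA₁⟩ := hcol N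
    obtain ⟨A₂, hA₂⟩ := hrow N
    have h1 : 0 ≤ A₁ := le_trans (by positivity) (hA₁ 0)
    have h2 : 0 ≤ A₂ := le_trans (by positivity) (hA₂ 0)
    refine ⟨A₁ + A₂ + A, fun n => ?_⟩
    refine (mul_le_mul_of_nonneg_right (norm_sub_le _ _) (by positivity)).trans ?_
    rw [add_mul]
    obtain ⟨m, rfl | rfl⟩ := n.eq_nat_or_neg
    · have e1 := hA₁ m
      have e2 := hA m 0
      have e3 : (-(m : ℤ)).toNat = 0 := by omega
      rw [e3, Int.toNat_natCast, Int.cast_natCast, abs_of_nonneg m.cast_nonneg]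
      simp only [Nat.cast_zero, add_zero, one_pow, mul_one] at e2
      linarith
    · have e1 := hA₂ m
      have e2 := hA 0 m
      have e3 : (-(m : ℤ)).toNat = 0 := by omega
      rw [e3, neg_neg, Int.toNat_natCast, Int.cast_neg, abs_neg, Int.cast_natCast,
        abs_of_nonneg m.cast_nonneg]
      simp only [Nat.cast_zero, add_zero, one_pow, one_mul] at e2
      linarith
  obtain ⟨f, hf⟩ := exists_smooth_fourierCoeff hβ
  obtain ⟨d, hd, hd'⟩ := exists_smoothCompact_coef E hγ'
  refine ⟨⟨_, f.1, f.2, d, hd, rfl⟩, fun k l => ?_⟩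
  rw [coef_add, coef_toeplitz, hf, hd',
    ← eq_of_diagonal_const (b := fun k l => L k l - γ k l) hdiag, sub_add_cancel]

/-! ### Matrix units and the shift -/

theorem coef_rankOne (E : HilbertBasis ℕ ℂ H) (k l i j : ℕ) :
    coef E (InnerProductSpace.rankOne ℂ (E k) (E l)) i j =
      (if i = k then 1 else 0) * (if l = j then 1 else 0) := by
  rw [coef, InnerProductSpace.rankOne_apply, inner_smul_right,
    orthonormal_iff_ite.1 E.orthonormal, orthonormal_iff_ite.1 E.orthonormal, mul_comm]

theorem rankOne_mem_smoothCompact (E : HilbertBasis ℕ ℂ H) (k l : ℕ) :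
    InnerProductSpace.rankOne ℂ (E k) (E l) ∈ smoothCompact E := by
  refine (isSmoothCompact_iff E _).2 fun N => ⟨(1 + (k : ℝ) + l) ^ N, fun i j => ?_⟩
  rw [coef_rankOne]
  by_cases h1 : i = k
  · by_cases h2 : l = j
    · simp [h1, h2]
    · simp only [h2, if_false, mul_zero, norm_zero]
      positivity
  · simp only [h1, if_false, zero_mul, norm_zero, mul_zero]
    positivity

/-- The matrix unit `P_{k,l}`. -/
def matrixUnit (E : HilbertBasis ℕ ℂ H) (k l : ℕ) : smoothToeplitz E :=
  ⟨InnerProductSpace.rankOne ℂ (E k) (E l),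
    mem_smoothToeplitz_of_mem_smoothCompact (rankOne_mem_smoothCompact E k l)⟩

theorem coef_matrixUnit_mul (E : HilbertBasis ℕ ℂ H) (i k j : ℕ) (a : smoothToeplitz E) :
    coef E (matrixUnit E i k * a : smoothToeplitz E) i j = coef E a k j := by
  rw [Subalgebra.coe_mul]
  change inner ℂ (E i) ((inner ℂ (E k) (a.1 (E j)) : ℂ) • E i) = inner ℂ (E k) (a.1 (E j))
  rw [inner_smul_right, orthonormal_iff_ite.1 E.orthonormal, if_pos rfl, mul_one]

theorem matrixUnit_apply_self (E : HilbertBasis ℕ ℂ H) (k l : ℕ) :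
    (matrixUnit E k l).1 (E l) = E k := by
  change (inner ℂ (E l) (E l) : ℂ) • E k = E k
  rw [orthonormal_iff_ite.1 E.orthonormal, if_pos rfl, one_smul]

theorem coef_mul_matrixUnit (E : HilbertBasis ℕ ℂ H) (i k l : ℕ) (a : smoothToeplitz E) :
    coef E (a * matrixUnit E l k : smoothToeplitz E) i k = coef E a i l := by
  rw [Subalgebra.coe_mul]
  change inner ℂ (E i) (a.1 ((matrixUnit E l k).1 (E k))) = _
  rw [matrixUnit_apply_self]
  rfl

theorem matrixUnit_mul_mul_matrixUnit (E : HilbertBasis ℕ ℂ H) (i k l j : ℕ)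
    (a : smoothToeplitz E) :
    matrixUnit E i k * (a * matrixUnit E l j) = coef E a k l • matrixUnit E i j := by
  refine Subtype.ext (ContinuousLinearMap.ext fun x => ?_)
  change (inner ℂ (E k) (a.1 ((inner ℂ (E j) x : ℂ) • E l)) : ℂ) • E i =
    coef E a k l • ((inner ℂ (E j) x : ℂ) • E i)
  rw [map_smul, inner_smul_right, smul_smul, mul_comm, coef]

theorem fourier_mem_smoothCircle (n : ℤ) : (fourier n : C(UnitAddCircle, ℂ)) ∈ smoothCircle := by
  change ContDiff ℝ ∞ fun x : ℝ => (fourier n (x : UnitAddCircle) : ℂ)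
  simp only [fourier_coe_apply]
  exact ((contDiff_const.mul Complex.ofRealCLM.contDiff).div_const _).cexp

/-- The function `e^{2πinx}`. -/
def smoothFourier (n : ℤ) : smoothCircle := ⟨fourier n, fourier_mem_smoothCircle n⟩

theorem fourierCoeff_smoothFourier (m n : ℤ) :
    fourierCoeff (smoothFourier n).1 m = if n = m then 1 else 0 := by
  rw [← fourierCoeffL_apply]
  exact fourierCoeffL_fourier m n

theorem circleDeriv_smoothFourier_one : circleDeriv (smoothFourier 1) = smoothFourier 1 := by
  refine Subtype.ext (fourierCoeff_injective fun n => ?_)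
  rw [fourierCoeff_circleDeriv, fourierCoeff_smoothFourier]
  split_ifs with h
  · simp [← h]
  · simp

theorem smoothFourier_mul_neg (n : ℤ) : smoothFourier n * smoothFourier (-n) = 1 := by
  refine Subtype.ext (ContinuousMap.ext fun x => ?_)
  change (fourier n x : ℂ) * fourier (-n) x = 1
  rw [← fourier_add, add_neg_cancel, fourier_zero]

/-- The unilateral shift `T(e^{2πix})`. -/
def shift (E : HilbertBasis ℕ ℂ H) : smoothToeplitz E := smoothToeplitzOf E (smoothFourier 1)

theorem coef_shift (E : HilbertBasis ℕ ℂ H) (k l : ℕ) :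
    coef E (shift E) k l = if k = l + 1 then 1 else 0 := by
  change coef E (toeplitz E _) k l = _
  rw [coef_toeplitz, fourierCoeff_smoothFourier]
  exact if_congr (by omega) rfl rfl

theorem coef_shift_mul (E : HilbertBasis ℕ ℂ H) (a : smoothToeplitz E) (k l : ℕ) :
    coef E (shift E * a : smoothToeplitz E) (k + 1) l = coef E a k l := by
  refine (hasSum_coef_mul E (shift E).1 a.1 (k + 1) l).unique
    ((hasSum_ite_eq k (coef E a k l)).congr_fun fun j => ?_)
  rw [coef_shift]
  by_cases h : j = k
  · simp [h]
  · have : ¬ k + 1 = j + 1 := fun h' => h (by omega)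
    rw [if_neg this, if_neg h, zero_mul]

/-! ### Derivations of the smooth Toeplitz algebra -/

/-- The matrix `L` with `δ a = [L, a]`. -/
def derivMatrix {E : HilbertBasis ℕ ℂ H} (δ : smoothToeplitz E →ₗ[ℂ] smoothToeplitz E) (k l : ℕ) :
    ℂ :=
  coef E (δ (matrixUnit E l 0)) k 0

/-- Right multiplication by `P_{l,0}` moves column `l` to column `0`. The first term on the right is
`(aL)_{k,l}`, so `δ(a) = [L, a]` reduces to showing that the left side is `(La)_{k,l}`. -/
theorem IsDerivation.coef_apply_mul_matrixUnit {E : HilbertBasis ℕ ℂ H}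
    {δ : smoothToeplitz E →ₗ[ℂ] smoothToeplitz E} (hδ : IsDerivation E δ) (a : smoothToeplitz E)
    (k l : ℕ) : coef E (δ (a * matrixUnit E l 0)) k 0 =
      coef E (a * δ (matrixUnit E l 0) : smoothToeplitz E) k 0 + coef E (δ a) k l := by
  rw [hδ, Subalgebra.coe_add, coef_add, coef_mul_matrixUnit]

/-- The Leibniz rule for `P_{0,k} (a P_{l,0}) = a_{k,l} P_{0,0}`, at the entry `(0, 0)`. Linearity
pulls the scalar out of `δ`, so no limit is exchanged with `δ`. -/
theorem IsDerivation.coef_matrixUnit_zero {E : HilbertBasis ℕ ℂ H}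
    {δ : smoothToeplitz E →ₗ[ℂ] smoothToeplitz E} (hδ : IsDerivation E δ) (a : smoothToeplitz E)
    (k l : ℕ) : coef E a k l * derivMatrix δ 0 0 = coef E (δ (a * matrixUnit E l 0)) k 0 +
      coef E (δ (matrixUnit E 0 k) * a : smoothToeplitz E) 0 l := by
  have h := hδ (matrixUnit E 0 k) (a * matrixUnit E l 0)
  rw [matrixUnit_mul_mul_matrixUnit, map_smul, ← mul_assoc] at h
  have h1 := congrArg (fun b : smoothToeplitz E => coef E b 0 0) h
  simp only [Subalgebra.coe_smul, coef_smul, Subalgebra.coe_add, coef_add] at h1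
  rw [coef_matrixUnit_mul, coef_mul_matrixUnit] at h1
  exact h1

/-- The case `a = 1`. It shows that the rows of `L`, which is defined through its columns, are also
rows of bounded operators up to the diagonal entry. -/
theorem IsDerivation.derivMatrix_eq {E : HilbertBasis ℕ ℂ H}
    {δ : smoothToeplitz E →ₗ[ℂ] smoothToeplitz E} (hδ : IsDerivation E δ) (k l : ℕ) :
    derivMatrix δ k l =
      (if k = l then derivMatrix δ 0 0 else 0) - coef E (δ (matrixUnit E 0 k)) 0 l := by
  have h := hδ.coef_matrixUnit_zero 1 k l
  have h1 : coef E (1 : smoothToeplitz E) k l = if k = l then 1 else 0 :=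
    orthonormal_iff_ite.1 E.orthonormal k l
  rw [one_mul, mul_one, h1, ite_mul, one_mul, zero_mul] at h
  rw [h, derivMatrix]
  ring

/-- Row `k` of `L` is `L_{0,0}` at position `k` minus row `0` of `δ(P_{0,k})`, so its product with
`a` converges although `L` is not yet known to be bounded. -/
theorem IsDerivation.hasSum_derivMatrix_mul {E : HilbertBasis ℕ ℂ H}
    {δ : smoothToeplitz E →ₗ[ℂ] smoothToeplitz E} (hδ : IsDerivation E δ) (a : smoothToeplitz E)
    (k l : ℕ) : HasSum (fun j => derivMatrix δ k j * coef E a j l)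
      (coef E (δ (a * matrixUnit E l 0)) k 0) := by
  have h1 := hasSum_coef_mul E (δ (matrixUnit E 0 k)).1 a.1 0 l
  have h2 := (hasSum_ite_eq k (coef E a k l * derivMatrix δ 0 0)).sub h1
  rw [hδ.coef_matrixUnit_zero, Subalgebra.coe_mul, add_sub_cancel_right] at h2
  refine h2.congr_fun fun j => ?_
  rw [hδ.derivMatrix_eq]
  by_cases h : j = k
  -- The rewriting of `h2` also expanded the summand at `j = k`; it is folded back here.
  · subst h
    simp only [if_true, ← Subalgebra.coe_mul]
    rw [← hδ.coef_matrixUnit_zero]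
    ring
  · rw [if_neg h, if_neg (Ne.symm h)]
    ring

theorem IsDerivation.eq_commutator {E : HilbertBasis ℕ ℂ H}
    {δ : smoothToeplitz E →ₗ[ℂ] smoothToeplitz E} (hδ : IsDerivation E δ) {B : smoothToeplitz E}
    (hB : ∀ k l, coef E B k l = derivMatrix δ k l) : δ = commutator B := by
  refine LinearMap.ext fun a => Subtype.ext (coef_ext E fun k l => ?_)
  have h1 : coef E (B * a : smoothToeplitz E) k l = coef E (δ (a * matrixUnit E l 0)) k 0 := by
    refine (hasSum_coef_mul E B.1 a.1 k l).unique ?_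
    simpa only [hB] using hδ.hasSum_derivMatrix_mul a k l
  have h2 : coef E (a * B : smoothToeplitz E) k l =
      coef E (a * δ (matrixUnit E l 0) : smoothToeplitz E) k 0 := by
    refine (hasSum_coef_mul E a.1 B.1 k l).unique ?_
    simp only [hB]
    exact hasSum_coef_mul E a.1 (δ (matrixUnit E l 0)).1 k 0
  rw [commutator_apply, Subalgebra.coe_sub, coef_sub, h1, h2, hδ.coef_apply_mul_matrixUnit]
  ring

theorem shift_mul_matrixUnit (E : HilbertBasis ℕ ℂ H) (l j : ℕ) :
    shift E * matrixUnit E l j = matrixUnit E (l + 1) j := by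
  refine Subtype.ext (coef_ext E fun k i => ?_)
  refine (hasSum_coef_mul E (shift E).1 (matrixUnit E l j).1 k i).unique
    ((hasSum_ite_eq l (coef E (matrixUnit E (l + 1) j).1 k i)).congr_fun fun m => ?_)
  rw [coef_shift, matrixUnit, matrixUnit, coef_rankOne, coef_rankOne]
  by_cases h : m = l <;> simp [h]

/-- The Leibniz rule for `U P_{l,0} = P_{l+1,0}`, where left multiplication by `U` shifts rows down
by one. -/
theorem IsDerivation.derivMatrix_succ {E : HilbertBasis ℕ ℂ H}
    {δ : smoothToeplitz E →ₗ[ℂ] smoothToeplitz E} (hδ : IsDerivation E δ) (k l : ℕ) :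
    derivMatrix δ (k + 1) (l + 1) = derivMatrix δ k l + coef E (δ (shift E)) (k + 1) l := by
  have h := hδ.coef_apply_mul_matrixUnit (shift E) (k + 1) l
  rwa [shift_mul_matrixUnit, coef_shift_mul] at h

/-- A derivation that maps the shift to a smooth compact operator is inner. -/
theorem IsDerivation.exists_eq_commutator {E : HilbertBasis ℕ ℂ H}
    {δ : smoothToeplitz E →ₗ[ℂ] smoothToeplitz E} (hδ : IsDerivation E δ)
    (hU : (δ (shift E) : H →L[ℂ] H) ∈ smoothCompact E) : ∃ B, δ = commutator B := by
  -- Both the first column and, through `derivMatrix_eq` at `k = 0`, the first row of `L` come from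
  -- the single element `δ(P_{0,0})`, whose matrix decays away from the diagonal.
  have hband : ∀ N, ∃ A, BandBound (coef E (δ (matrixUnit E 0 0))) N A := fun N => by
    obtain ⟨A, hA⟩ := exists_symbolBound (δ (matrixUnit E 0 0)) N
    exact ⟨_, hA.bandBound⟩
  have hcol : ∀ N, ∃ A : ℝ, ∀ k : ℕ, ‖derivMatrix δ k 0‖ * (1 + (k : ℝ)) ^ N ≤ A := fun N => by
    obtain ⟨A, hA⟩ := hband N
    refine ⟨A, fun k => ?_⟩
    simpa [derivMatrix] using hA k 0
  have hrow : ∀ N, ∃ A : ℝ, ∀ l : ℕ, ‖derivMatrix δ 0 l‖ * (1 + (l : ℝ)) ^ N ≤ A := fun N => by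
    obtain ⟨A, hA⟩ := hband N
    refine ⟨‖derivMatrix δ 0 0‖ + A, fun l => ?_⟩
    rw [hδ.derivMatrix_eq]
    refine (mul_le_mul_of_nonneg_right (norm_sub_le _ _) (by positivity)).trans ?_
    rw [add_mul]
    refine add_le_add ?_ ?_
    · rcases l with _ | l <;> simp
    · simpa using hA 0 l
  obtain ⟨B, hB⟩ := exists_coef_eq_of_diagonal E (exists_matrixBound hU) hcol hrow
    hδ.derivMatrix_succ
  exact ⟨B, hδ.eq_commutator hB⟩

theorem IsDerivation.sub {E : HilbertBasis ℕ ℂ H}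
    {δ δ' : smoothToeplitz E →ₗ[ℂ] smoothToeplitz E} (hδ : IsDerivation E δ)
    (hδ' : IsDerivation E δ') : IsDerivation E (δ - δ') := fun a b => by
  simp only [LinearMap.sub_apply, hδ a b, hδ' a b, mul_sub, sub_mul]
  abel

theorem hasSymbol_vectorFieldDeriv_shift (E : HilbertBasis ℕ ℂ H) (F : smoothCircle) :
    HasSymbol E (vectorFieldDeriv E F (shift E)) (F * smoothFourier 1) := by
  have := (hasSymbol_smoothToeplitzOf E (smoothFourier 1)).vectorFieldDeriv F
  rwa [circleDeriv_smoothFourier_one] at this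

theorem IsDerivation.exists_eq_vectorFieldDeriv_add {E : HilbertBasis ℕ ℂ H}
    {δ : smoothToeplitz E →ₗ[ℂ] smoothToeplitz E} (hδ : IsDerivation E δ) :
    ∃ (F : smoothCircle) (B : smoothToeplitz E), δ = vectorFieldDeriv E F + commutator B := by
  obtain ⟨g, hg⟩ := exists_hasSymbol (δ (shift E))
  -- As `e^{2πix}` is fixed by `(1 / 2πi) d/dx`, the symbol of `δ_F(U)` is `F e^{2πix}`; this forces
  -- `F = g e^{-2πix}`.
  have h1 : g * smoothFourier (-1) * smoothFourier 1 = g := by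
    rw [mul_assoc, mul_comm (smoothFourier (-1)), smoothFourier_mul_neg, mul_one]
  have h2 := hasSymbol_vectorFieldDeriv_shift E (g * smoothFourier (-1))
  rw [h1] at h2
  obtain ⟨B, hB⟩ := (hδ.sub (isDeltaF_vectorFieldDeriv E
    (g * smoothFourier (-1))).isDerivation).exists_eq_commutator (hg.sub_mem h2)
  exact ⟨_, B, LinearMap.ext fun a => by
    rw [LinearMap.add_apply, ← hB, LinearMap.sub_apply, add_sub_cancel]⟩

end QuantumDisk

end

/-! ### The main theorem -/

theorem mainTheorem1 {H : Type*} [NormedAddCommGroup H] [InnerProductSpace ℂ H] [CompleteSpace H]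
    (E : HilbertBasis ℕ ℂ H) :
    (∀ F : smoothCircle, ∃ δF : smoothToeplitz E →ₗ[ℂ] smoothToeplitz E,
      IsDeltaF E F δF ∧ (∀ δ', IsDeltaF E F δ' → δ' = δF) ∧
      IsDerivation E δF ∧ IsFrechetContinuous E δF ∧
      ∀ (a : smoothToeplitz E) (f : smoothCircle), HasSymbol E a f →
        HasSymbol E (δF a) (F * circleDeriv f)) ∧
    ∀ δ : smoothToeplitz E →ₗ[ℂ] smoothToeplitz E, IsDerivation E δ →
      IsFrechetContinuous E δ ∧
      ∃! F : smoothCircle, ∃ δF δ₀ : smoothToeplitz E →ₗ[ℂ] smoothToeplitz E,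
        IsDeltaF E F δF ∧ IsInnerDerivation E δ₀ ∧
        (∀ a, (δ₀ a : H →L[ℂ] H) ∈ smoothCompact E) ∧ δ = δF + δ₀ := by
  refine ⟨fun F => ⟨vectorFieldDeriv E F, isDeltaF_vectorFieldDeriv E F,
    fun δ' h => h.unique (isDeltaF_vectorFieldDeriv E F),
    (isDeltaF_vectorFieldDeriv E F).isDerivation, (isTame_vectorFieldDeriv E F).continuous,
    fun a f h => h.vectorFieldDeriv F⟩, fun δ hδ => ?_⟩
  obtain ⟨F, B, rfl⟩ := hδ.exists_eq_vectorFieldDeriv_add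
  refine ⟨((isTame_vectorFieldDeriv E F).add (isTame_commutator B)).continuous, F,
    ⟨vectorFieldDeriv E F, commutator B, isDeltaF_vectorFieldDeriv E F, ⟨B, fun a => rfl⟩,
      commutator_mem_smoothCompact B, rfl⟩, ?_⟩
  rintro G ⟨δG, δ₀, hG, -, h₀, h⟩
  rw [hG.unique (isDeltaF_vectorFieldDeriv E G)] at h
  -- Evaluation at `U` gives two symbols, `F e^{2πix}` and `G e^{2πix}`, of one operator; the factor
  -- `e^{2πix}` is invertible.
  have h1 := (hasSymbol_vectorFieldDeriv_shift E F).add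
    (hasSymbol_zero_iff.2 (commutator_mem_smoothCompact B (shift E)))
  have h2 := (hasSymbol_vectorFieldDeriv_shift E G).add (hasSymbol_zero_iff.2 (h₀ (shift E)))
  rw [add_zero] at h1 h2
  have h3 := LinearMap.congr_fun h (shift E)
  rw [LinearMap.add_apply, LinearMap.add_apply, commutator_apply] at h3
  rw [h3] at h1
  have h4 := congrArg (· * smoothFourier (-1)) (h2.unique h1)
  simpa only [mul_assoc, smoothFourier_mul_neg, mul_one] using h4
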